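/- Let $A(v)$ denote the area of a round sphere in hyperbolic space $\mathbf{H}^3$ that encloses volume $v$, and let $A(v,w)$ denote the area of the standard double bubble in $\mathbf{H}^3$ that encloses and separates regions of volumes $v$ and $w$. A standard double bubble consists of two outer caps, which are parts of round spheres, and an inner cap, which is part of a sphere, horosphere, hyposphere (equidistant surface) or geodesic plane; the three caps have a common boundary circle, along which they meet at angles of $120^\circ$. The Hutchings function of $\mathbf{H}^3$ is $$F(v,w)=2A\left(\tfrac v2\right)+A(w)+A(v+w)-2A(v,w).$$ Let $\lambda = e^2/4-1\approx 0.847$. Then for all real $v,w$ with $v\le w$, $w>300$ and $v\ge\lambda w$, the quantities that enter $F(v,w)$ are well defined (up to isometry there is exactly one round sphere enclosing each of the volumes $v/2$, $w$, $v+w$, and exactly one standard double bubble enclosing volumes $v$ and $w$, in this order), and $$F(v,w)>0.$$ -/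

import Mathlib

open scoped RealInnerProductSpace

noncomputable section

namespace HypBubble

/-- The plane, used for parametrizing surfaces. -/
abbrev E2 := EuclideanSpace ℝ (Fin 2)

/-- Euclidean three-space; hyperbolic space `H³` is its open unit ball with the conformal metric
`(2 / (1 - |x|²))² |dx|²` (the Poincaré ball model). -/
abbrev E3 := EuclideanSpace ℝ (Fin 3)

/-- The open unit ball, the underlying set of `H³`. -/
def H3 : Set E3 := Metric.ball 0 1

/-- The conformal factor of the hyperbolic metric. -/
def conf (x : E3) : ℝ := 2 / (1 - ‖x‖ ^ 2)

/-- Hyperbolic volume: the Riemannian measure of the Poincaré ball model. -/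
def hypVol : MeasureTheory.Measure E3 :=
  (MeasureTheory.volume.restrict H3).withDensity fun x => ENNReal.ofReal (conf x ^ 3)

/-- The Euclidean area density `√ det (⟨∂ᵢX, ∂ⱼX⟩)` of a parametrized surface `X`. -/
def areaDensity (X : E2 → E3) (p : E2) : ℝ :=
  let a := fderiv ℝ X p (EuclideanSpace.single 0 1)
  let b := fderiv ℝ X p (EuclideanSpace.single 1 1)
  √(‖a‖ ^ 2 * ‖b‖ ^ 2 - ⟪a, b⟫ ^ 2)

/-- The hyperbolic area of the surface in `H³` parametrized by `X` on `D`. -/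
def hypArea (X : E2 → E3) (D : Set E2) : ℝ :=
  ∫ p in D, conf (X p) ^ 2 * areaDensity X p

/-! ### Spherical caps over a circle

Fix the circle `{x | x 2 = 0, ‖x‖ = ρ}`. The spherical caps (and the flat disc) bounded by it are
the level sets of one angular coordinate, namely the angle between the cap and the flat disc, which
is counted positive for caps above the disc and negative for caps below it. Spheres,
horospheres, hypospheres (equidistant surfaces) and geodesic planes of `H³` are exactly the
intersections of Euclidean spheres and planes with the unit ball, and since the model is conformal,
Euclidean angles are hyperbolic angles. -/

/-- The angular coordinate of `x` relative to the circle of radius `ρ`. It takes the value `φ` on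
the cap that meets the flat disc at the signed angle `φ`: that cap lies on the sphere (or plane)
`sin φ * (‖x‖² - ρ²) + 2 * ρ * cos φ * x₃ = 0`. -/
def capAngle (ρ : ℝ) (x : E3) : ℝ :=
  Complex.arg ⟨ρ ^ 2 - ‖x‖ ^ 2, 2 * ρ * x 2⟩

/-- The (open) spherical cap that is bounded by the circle of radius `ρ` and meets the flat disc
at the signed angle `φ`. It is smaller than a hemisphere for `|φ| < π / 2`, and larger for
`|φ| > π / 2`. -/
def cap (ρ φ : ℝ) : Set E3 :=
  {x | ¬(x 2 = 0 ∧ ‖x‖ = ρ) ∧ capAngle ρ x = φ}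

/-- A rational parametrization of `cap ρ φ` by the unit disc. -/
def capParam (ρ φ : ℝ) (p : E2) : E3 :=
  (ρ / (Real.cos (φ / 2) ^ 2 + Real.sin (φ / 2) ^ 2 * ‖p‖ ^ 2)) •
    !₂[p 0, p 1, Real.sin (φ / 2) * Real.cos (φ / 2) * (1 - ‖p‖ ^ 2)]

/-! ### The parametrization is correct -/

theorem norm_sq_E3 (x : E3) : ‖x‖ ^ 2 = x 0 ^ 2 + x 1 ^ 2 + x 2 ^ 2 := by
  rw [EuclideanSpace.real_norm_sq_eq, Fin.sum_univ_three]

theorem norm_sq_E2 (x : E2) : ‖x‖ ^ 2 = x 0 ^ 2 + x 1 ^ 2 := by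
  rw [EuclideanSpace.real_norm_sq_eq, Fin.sum_univ_two]

theorem capParam_coords {ρ φ : ℝ} (h1 : -Real.pi < φ) (h2 : φ < Real.pi) (p : E2) :
    0 < Real.cos (φ / 2) ^ 2 + Real.sin (φ / 2) ^ 2 * ‖p‖ ^ 2 ∧
    ρ ^ 2 - ‖capParam ρ φ p‖ ^ 2 = ρ ^ 2 * (1 - ‖p‖ ^ 2) /
      (Real.cos (φ / 2) ^ 2 + Real.sin (φ / 2) ^ 2 * ‖p‖ ^ 2) * Real.cos φ ∧
    2 * ρ * capParam ρ φ p 2 = ρ ^ 2 * (1 - ‖p‖ ^ 2) /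
      (Real.cos (φ / 2) ^ 2 + Real.sin (φ / 2) ^ 2 * ‖p‖ ^ 2) * Real.sin φ := by
  have hc : 0 < Real.cos (φ / 2) := Real.cos_pos_of_mem_Ioo ⟨by linarith, by linarith⟩
  have hsc := Real.sin_sq_add_cos_sq (φ / 2)
  have hcos : Real.cos φ = Real.cos (φ / 2) ^ 2 - Real.sin (φ / 2) ^ 2 := by
    rw [← Real.cos_two_mul', show 2 * (φ / 2) = φ by ring]
  have hsin : Real.sin φ = 2 * Real.sin (φ / 2) * Real.cos (φ / 2) := by
    rw [← Real.sin_two_mul, show 2 * (φ / 2) = φ by ring]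
  have hpn := norm_sq_E2 p
  set c := Real.cos (φ / 2) with hcd
  set s := Real.sin (φ / 2) with hsd
  set P := ‖p‖ ^ 2 with hPd
  have hP : 0 ≤ P := by positivity
  have hD : 0 < c ^ 2 + s ^ 2 * P := by positivity
  have hz : capParam ρ φ p 2 = ρ / (c ^ 2 + s ^ 2 * P) * (s * c * (1 - P)) := by
    simp [capParam, hPd, hcd, hsd]
  have hN : ‖capParam ρ φ p‖ ^ 2 =
      (ρ / (c ^ 2 + s ^ 2 * P)) ^ 2 * (P + (s * c * (1 - P)) ^ 2) := by
    have hx0 : capParam ρ φ p 0 = ρ / (c ^ 2 + s ^ 2 * P) * p 0 := by simp [capParam, hPd, hcd, hsd]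
    have hx1 : capParam ρ φ p 1 = ρ / (c ^ 2 + s ^ 2 * P) * p 1 := by simp [capParam, hPd, hcd, hsd]
    rw [norm_sq_E3, hz, hx0, hx1]
    linear_combination -(ρ / (c ^ 2 + s ^ 2 * P)) ^ 2 * hpn
  refine ⟨hD, ?_, ?_⟩
  · rw [hN, hcos]
    field_simp
    have h4 : s ^ 2 = 1 - c ^ 2 := by linarith
    rw [h4]
    ring
  · rw [hz, hsin]
    field_simp

/-- The parametrization runs through each point of the cap exactly once. -/
theorem capParam_bijOn {ρ φ : ℝ} (hρ : 0 < ρ) (h1 : -Real.pi < φ) (h2 : φ < Real.pi) :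
    Set.BijOn (capParam ρ φ) (Metric.ball 0 1) (cap ρ φ) := by
  have hsc := Real.sin_sq_add_cos_sq (φ / 2)
  have hsc' := Real.sin_sq_add_cos_sq φ
  refine ⟨fun p hp => ?_, fun p hp q hq hpq => ?_, fun x hx => ?_⟩
  · have hp1 : ‖p‖ < 1 := by simpa using hp
    obtain ⟨hD, e1, e2⟩ := capParam_coords (ρ := ρ) h1 h2 p
    have hP1 : 0 < 1 - ‖p‖ ^ 2 := by nlinarith [norm_nonneg p]
    set k := ρ ^ 2 * (1 - ‖p‖ ^ 2) /
      (Real.cos (φ / 2) ^ 2 + Real.sin (φ / 2) ^ 2 * ‖p‖ ^ 2) with hkd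
    have hk : 0 < k := by positivity
    refine ⟨?_, ?_⟩
    · rintro ⟨a, b⟩
      rw [b, sub_self] at e1
      rw [a, mul_zero] at e2
      have f1 : Real.cos φ = 0 := by simpa [hk.ne'] using e1.symm
      have f2 : Real.sin φ = 0 := by simpa [hk.ne'] using e2.symm
      simp [f1, f2] at hsc'
    · rw [capAngle, e1, e2]
      have h := Complex.arg_mul_cos_add_sin_mul_I hk (θ := φ) ⟨h1, h2.le⟩
      convert h using 2
      apply Complex.ext <;> simp [Complex.cos_ofReal_re, Complex.sin_ofReal_re]
  · obtain ⟨hD, e1, e2⟩ := capParam_coords (ρ := ρ) h1 h2 p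
    obtain ⟨hD', e1', e2'⟩ := capParam_coords (ρ := ρ) h1 h2 q
    rw [← hpq] at e1' e2'
    rw [e1] at e1'
    rw [e2] at e2'
    have hk : ρ ^ 2 * (1 - ‖p‖ ^ 2) /
          (Real.cos (φ / 2) ^ 2 + Real.sin (φ / 2) ^ 2 * ‖p‖ ^ 2) =
        ρ ^ 2 * (1 - ‖q‖ ^ 2) /
          (Real.cos (φ / 2) ^ 2 + Real.sin (φ / 2) ^ 2 * ‖q‖ ^ 2) := by
      linear_combination Real.cos φ * e1' + Real.sin φ * e2' -
        (ρ ^ 2 * (1 - ‖p‖ ^ 2) /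
          (Real.cos (φ / 2) ^ 2 + Real.sin (φ / 2) ^ 2 * ‖p‖ ^ 2) -
        ρ ^ 2 * (1 - ‖q‖ ^ 2) /
          (Real.cos (φ / 2) ^ 2 + Real.sin (φ / 2) ^ 2 * ‖q‖ ^ 2)) * hsc'
    rw [div_eq_div_iff hD.ne' hD'.ne'] at hk
    have hρ2 : ρ ^ 2 ≠ 0 := by positivity
    have hPQ : ‖p‖ ^ 2 = ‖q‖ ^ 2 := by
      apply mul_left_cancel₀ hρ2
      linear_combination -hk + ρ ^ 2 * (‖q‖ ^ 2 - ‖p‖ ^ 2) * hsc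
    have hne : ρ / (Real.cos (φ / 2) ^ 2 + Real.sin (φ / 2) ^ 2 * ‖q‖ ^ 2) ≠ 0 := by positivity
    have g0 := congrArg (fun y : E3 => y 0) hpq
    have g1 := congrArg (fun y : E3 => y 1) hpq
    simp only [capParam, hPQ] at g0 g1
    ext i
    fin_cases i
    · exact mul_left_cancel₀ hne (by simpa using g0)
    · exact mul_left_cancel₀ hne (by simpa using g1)
  · obtain ⟨hx0, hxa⟩ := hx
    set ζ : ℂ := ⟨ρ ^ 2 - ‖x‖ ^ 2, 2 * ρ * x 2⟩ with hζ
    have hζ0 : ζ ≠ 0 := by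
      intro h
      have a := congrArg Complex.re h
      have b := congrArg Complex.im h
      simp only [hζ, Complex.zero_re, Complex.zero_im] at a b
      refine hx0 ⟨by simpa [hρ.ne'] using b, ?_⟩
      exact (sq_eq_sq₀ (norm_nonneg x) hρ.le).mp (by linarith)
    have hk : 0 < ‖ζ‖ := norm_pos_iff.mpr hζ0
    have ha : Complex.arg ζ = φ := hxa
    have e1 : ‖ζ‖ * Real.cos φ = ρ ^ 2 - ‖x‖ ^ 2 := by rw [← ha, Complex.norm_mul_cos_arg]
    have e2 : ‖ζ‖ * Real.sin φ = 2 * ρ * x 2 := by rw [← ha, Complex.norm_mul_sin_arg]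
    have hcos : Real.cos φ = Real.cos (φ / 2) ^ 2 - Real.sin (φ / 2) ^ 2 := by
      rw [← Real.cos_two_mul', show 2 * (φ / 2) = φ by ring]
    have hsin : Real.sin φ = 2 * Real.sin (φ / 2) * Real.cos (φ / 2) := by
      rw [← Real.sin_two_mul, show 2 * (φ / 2) = φ by ring]
    have hn := norm_sq_E3 x
    set k := ‖ζ‖
    set N := ‖x‖ ^ 2 with hN
    have hN0 : 0 ≤ N := by positivity
    have hM : 0 < N + ρ ^ 2 + k := by positivity
    let p : E2 := !₂[2 * ρ / (N + ρ ^ 2 + k) * x 0, 2 * ρ / (N + ρ ^ 2 + k) * x 1]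
    have hP : ‖p‖ ^ 2 = (N + ρ ^ 2 - k) / (N + ρ ^ 2 + k) := by
      have h5 : k ^ 2 = (ρ ^ 2 - N) ^ 2 + (2 * ρ * x 2) ^ 2 := by
        rw [← e1, ← e2]
        linear_combination -k ^ 2 * hsc'
      rw [norm_sq_E2]
      simp only [p, Matrix.cons_val_zero, Matrix.cons_val_one]
      field_simp
      linear_combination h5 - 4 * ρ ^ 2 * hn
    have hDp : Real.cos (φ / 2) ^ 2 + Real.sin (φ / 2) ^ 2 * ‖p‖ ^ 2 =
        2 * ρ ^ 2 / (N + ρ ^ 2 + k) := by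
      rw [hP]
      field_simp
      linear_combination (N + ρ ^ 2) * hsc + e1 - k * hcos
    refine ⟨p, ?_, ?_⟩
    · have : ‖p‖ ^ 2 < 1 := by
        rw [hP, div_lt_one hM]
        linarith
      have h6 : ‖p‖ < 1 := by nlinarith [norm_nonneg p]
      simpa using h6
    · ext i
      fin_cases i
      · simp [capParam, hDp, p]
        field_simp
      · simp [capParam, hDp, p]
        field_simp
      · simp only [capParam, hDp]
        rw [hP]
        simp
        field_simp
        linear_combination e2 - k * hsin

/-- At a boundary point `p` of the disc, moving inwards along the cap, one leaves the bounding
circle in the direction that makes the signed angle `φ` with the flat disc. -/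
theorem hasDerivAt_capParam (ρ φ : ℝ) {p : E2} (hp : ‖p‖ = 1) :
    HasDerivAt (fun t : ℝ => capParam ρ φ ((1 - t) • p))
      (ρ • (Real.cos φ • !₂[-p 0, -p 1, 0] + Real.sin φ • !₂[0, 0, 1])) 0 := by
  have hsc := Real.sin_sq_add_cos_sq (φ / 2)
  have hcos : Real.cos φ = Real.cos (φ / 2) ^ 2 - Real.sin (φ / 2) ^ 2 := by
    rw [← Real.cos_two_mul', show 2 * (φ / 2) = φ by ring]
  have hsin : Real.sin φ = 2 * Real.sin (φ / 2) * Real.cos (φ / 2) := by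
    rw [← Real.sin_two_mul, show 2 * (φ / 2) = φ by ring]
  have hnorm : ∀ t : ℝ, ‖(1 - t) • p‖ ^ 2 = (1 - t) ^ 2 := by
    intro t
    rw [norm_smul, hp, mul_one, Real.norm_eq_abs, sq_abs]
  have hlin : HasDerivAt (fun t : ℝ => 1 - t) (-1) 0 := by
    simpa using (hasDerivAt_id (0 : ℝ)).const_sub 1
  have hsq : HasDerivAt (fun t : ℝ => (1 - t) ^ 2) (-2) 0 := by
    simpa using hlin.fun_pow 2
  have hden : HasDerivAt (fun t : ℝ => Real.cos (φ / 2) ^ 2 + Real.sin (φ / 2) ^ 2 * (1 - t) ^ 2)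
      (Real.sin (φ / 2) ^ 2 * -2) 0 := by
    simpa using (hsq.const_mul (Real.sin (φ / 2) ^ 2)).const_add (Real.cos (φ / 2) ^ 2)
  have hd0 : Real.cos (φ / 2) ^ 2 + Real.sin (φ / 2) ^ 2 * (1 - (0 : ℝ)) ^ 2 = 1 := by
    linarith
  have hfac := (hasDerivAt_const (0 : ℝ) ρ).fun_div hden (by rw [hd0]; exact one_ne_zero)
  rw [hd0] at hfac
  suffices H : ∀ i, HasDerivAt (fun t : ℝ => capParam ρ φ ((1 - t) • p) i)
      ((ρ • (Real.cos φ • !₂[-p 0, -p 1, 0] + Real.sin φ • !₂[0, 0, 1]) : E3) i) 0 by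
    rw [hasDerivAt_iff_hasFDerivAt, ← hasFDerivWithinAt_univ, hasFDerivWithinAt_euclidean]
    intro i
    have h := (H i).hasFDerivAt.hasFDerivWithinAt (s := Set.univ)
    refine h.congr_fderiv (ContinuousLinearMap.ext fun t => ?_)
    simp
    ring
  intro i
  fin_cases i
  · refine ((hfac.fun_mul (hlin.mul_const (p 0))).congr_deriv ?_).congr_of_eventuallyEq
      (Filter.Eventually.of_forall fun t => ?_)
    · simp [hcos]
      linear_combination ρ * p 0 * hsc
    · simp [capParam, hnorm]
  · refine ((hfac.fun_mul (hlin.mul_const (p 1))).congr_deriv ?_).congr_of_eventuallyEq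
      (Filter.Eventually.of_forall fun t => ?_)
    · simp [hcos]
      linear_combination ρ * p 1 * hsc
    · simp [capParam, hnorm]
  · refine ((hfac.fun_mul ((hsq.const_sub 1).const_mul
      (Real.sin (φ / 2) * Real.cos (φ / 2)))).congr_deriv ?_).congr_of_eventuallyEq
      (Filter.Eventually.of_forall fun t => ?_)
    · simp only [hsin]
      simp
      left
      ring
    · simp [capParam, hnorm]

/-- The hyperbolic area of a cap. -/
def capArea (ρ φ : ℝ) : ℝ := hypArea (capParam ρ φ) (Metric.ball 0 1)

/-! ### Round spheres -/

/-- A round (geodesic) sphere in `H³`, moved by an isometry so that its centre is the origin;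
`R` is its Euclidean radius in the model. -/
structure RoundSphere where
  R : ℝ
  R_pos : 0 < R
  R_lt_one : R < 1

/-- The sphere encloses a ball of hyperbolic volume `v`. -/
def RoundSphere.Encloses (S : RoundSphere) (v : ℝ) : Prop :=
  hypVol (Metric.ball 0 S.R) = ENNReal.ofReal v

/-- The hyperbolic area of a round sphere, as the sum of those of its two open hemispheres. -/
def RoundSphere.area (S : RoundSphere) : ℝ :=
  capArea S.R (Real.pi / 2) + capArea S.R (-(Real.pi / 2))

open Classical in
/-- `A(v)`: the area of the round sphere that encloses volume `v`. -/
def sphereArea (v : ℝ) : ℝ :=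
  if h : ∃ S : RoundSphere, S.Encloses v then h.choose.area else 0

/-! ### Standard double bubbles -/

/-- A standard double bubble in `H³`: three caps over a common circle that meet there at angles of
`120°`, the two outer caps being parts of (compact) round spheres of `H³`. It is moved by an
isometry so that the common circle is centred at the origin and lies in the horizontal plane.
The inner cap meets the flat disc at the angle `θ`, and the outer caps at `θ + 2π/3` (above) and
`θ - 2π/3` (below). The inner cap may lie on a sphere, a horosphere, a hyposphere or a geodesic
plane. -/
structure StandardDoubleBubble where
  ρ : ℝ
  θ : ℝ
  ρ_pos : 0 < ρ
  ρ_lt_one : ρ < 1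
  θ_gt : -(Real.pi / 3) < θ
  θ_lt : θ < Real.pi / 3
  upper_subset : cap ρ (θ + 2 * Real.pi / 3) ⊆ H3
  lower_subset : cap ρ (θ - 2 * Real.pi / 3) ⊆ H3

namespace StandardDoubleBubble

/-- The first region, between the inner cap and the upper outer cap. -/
def upperRegion (B : StandardDoubleBubble) : Set E3 :=
  {x | B.θ < capAngle B.ρ x ∧ capAngle B.ρ x < B.θ + 2 * Real.pi / 3}

/-- The second region, between the lower outer cap and the inner cap. -/
def lowerRegion (B : StandardDoubleBubble) : Set E3 :=
  {x | B.θ - 2 * Real.pi / 3 < capAngle B.ρ x ∧ capAngle B.ρ x < B.θ}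

/-- The double bubble encloses and separates regions of hyperbolic volumes `v` and `w`. -/
def Encloses (B : StandardDoubleBubble) (v w : ℝ) : Prop :=
  hypVol B.upperRegion = ENNReal.ofReal v ∧ hypVol B.lowerRegion = ENNReal.ofReal w

/-- The hyperbolic area of the double bubble: the sum of the areas of the three caps. -/
def area (B : StandardDoubleBubble) : ℝ :=
  capArea B.ρ (B.θ + 2 * Real.pi / 3) + capArea B.ρ (B.θ - 2 * Real.pi / 3) + capArea B.ρ B.θ

end StandardDoubleBubble

open Classical in
/-- `A(v, w)`: the area of the standard double bubble enclosing volumes `v` and `w`. -/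
def doubleBubbleArea (v w : ℝ) : ℝ :=
  if h : ∃ B : StandardDoubleBubble, B.Encloses v w then h.choose.area else 0

/-- The Hutchings function `F(v, w)` of `H³`. -/
def hutchings (v w : ℝ) : ℝ :=
  2 * sphereArea (v / 2) + sphereArea w + sphereArea (v + w) - 2 * doubleBubbleArea v w

/-- All the areas that enter `F(v, w)` are well defined: up to isometry there is exactly one round
sphere enclosing each of the volumes `v / 2`, `w`, `v + w`, and exactly one standard double bubble
enclosing the volumes `v` and `w`. -/
def HutchingsDefined (v w : ℝ) : Prop :=
  (∃! S : RoundSphere, S.Encloses (v / 2)) ∧ (∃! S : RoundSphere, S.Encloses w) ∧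
    (∃! S : RoundSphere, S.Encloses (v + w)) ∧ ∃! B : StandardDoubleBubble, B.Encloses v w

end HypBubble

end

noncomputable section

namespace HypBubble

/-! All caps over one circle are level sets of an angle φ, so areas and volumes are computed in the
coordinates (p, φ) of `capMap`. With D = 1 + `ch` ρ · cos φ, a cap has area 2π `sh`²/D
(`capArea_eq`), and the volume between two caps is π times the integral of `sh`³/D² over φ
(`hypVol_region`), which has the elementary antiderivative `capPrim`.

Both volumes of a bubble increase with ρ, while increasing θ enlarges one region and shrinks the
other. This gives uniqueness (`bubble_unique`); existence (`bubble_exists`) follows by using the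
intermediate value theorem first in ρ and then in θ.

For positivity, a sphere of diameter x has volume π(sinh x − x) and area 2π(cosh x − 1). Hence
area/2π is volume/π plus the defect x − 1 + exp(−x), which for large volumes is about log(2 ·
volume/π) − 1. For a large bubble, `ch` is near 2 and the denominators a, b of the outer caps are
near 0. Its volumes over π are then close to p − log p and q − log q, where p and q are the
arguments of the logarithms in `capPrim`. In F/2π the terms of order 1/a and 1/b cancel up to a
constant 2 (`area_term_le`). If v + w = (e²/4)w, the bounded and logarithmic terms are 2(log p − 1)
+ (log 2 + log q − 1) + (log(e²q/2) − 1) − 2 log p − 2 log q + 2 = 0. So λ is the value at which the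
constants cancel, and the sign is decided by terms of order (log q)/q. There the two spheres of
volume v/2 gain with coefficient 2, while the sphere of volume v + w loses only with coefficient 1 −
4/e² ≈ 0.46 (`numerical_gain`). -/

/-! ### Cap coordinates: Jacobian, area density and conformal factor. -/

/-- The denominator of `capParam`, in terms of the half angle `φ / 2` and of `‖p‖ ^ 2`. -/
def capDen (φ P : ℝ) : ℝ := Real.cos (φ / 2) ^ 2 + Real.sin (φ / 2) ^ 2 * P

theorem capDen_pos {φ P : ℝ} (h1 : -Real.pi < φ) (h2 : φ < Real.pi) (hP : 0 ≤ P) :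
    0 < capDen φ P := by
  have hc : 0 < Real.cos (φ / 2) := Real.cos_pos_of_mem_Ioo ⟨by linarith, by linarith⟩
  unfold capDen
  positivity

theorem capParam_zero (ρ φ : ℝ) (p : E2) :
    capParam ρ φ p 0 = ρ / capDen φ (p 0 ^ 2 + p 1 ^ 2) * p 0 := by
  simp [capParam, capDen, norm_sq_E2]

theorem capParam_one (ρ φ : ℝ) (p : E2) :
    capParam ρ φ p 1 = ρ / capDen φ (p 0 ^ 2 + p 1 ^ 2) * p 1 := by
  simp [capParam, capDen, norm_sq_E2]

theorem capParam_two (ρ φ : ℝ) (p : E2) :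
    capParam ρ φ p 2 = ρ / capDen φ (p 0 ^ 2 + p 1 ^ 2) *
      (Real.sin (φ / 2) * Real.cos (φ / 2) * (1 - (p 0 ^ 2 + p 1 ^ 2))) := by
  simp [capParam, capDen, norm_sq_E2]

/-- The Jacobian matrix of `(p, φ) ↦ capParam ρ φ p`. -/
def capJac (ρ φ x y : ℝ) : Matrix (Fin 3) (Fin 3) ℝ :=
  let s := Real.sin (φ / 2)
  let c := Real.cos (φ / 2)
  let Q := 1 - (x ^ 2 + y ^ 2)
  let D := capDen φ (x ^ 2 + y ^ 2)
  !![ρ / D - 2 * ρ * s ^ 2 * x * x / D ^ 2, -(2 * ρ * s ^ 2 * y * x / D ^ 2),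
      ρ * s * c * Q * x / D ^ 2;
    -(2 * ρ * s ^ 2 * x * y / D ^ 2), ρ / D - 2 * ρ * s ^ 2 * y * y / D ^ 2,
      ρ * s * c * Q * y / D ^ 2;
    -(2 * ρ * s * c * x / D) - 2 * ρ * s ^ 2 * x * (s * c * Q) / D ^ 2,
      -(2 * ρ * s * c * y / D) - 2 * ρ * s ^ 2 * y * (s * c * Q) / D ^ 2,
      ρ * (c ^ 2 - s ^ 2) / 2 * Q / D + ρ * s * c * Q * (s * c * Q) / D ^ 2]

theorem det_capJac {ρ φ x y : ℝ} (hD : capDen φ (x ^ 2 + y ^ 2) ≠ 0) :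
    (capJac ρ φ x y).det =
      ρ ^ 3 * (1 - (x ^ 2 + y ^ 2)) / (2 * capDen φ (x ^ 2 + y ^ 2) ^ 3) := by
  have hsc := Real.sin_sq_add_cos_sq (φ / 2)
  have hDd : capDen φ (x ^ 2 + y ^ 2) =
    Real.cos (φ / 2) ^ 2 + Real.sin (φ / 2) ^ 2 * (x ^ 2 + y ^ 2) := rfl
  rw [capJac, Matrix.det_fin_three]
  simp only [Matrix.of_apply, Matrix.cons_val', Matrix.cons_val_zero, Matrix.cons_val_one,
    Matrix.cons_val, Matrix.cons_val_fin_one]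
  set D := capDen φ (x ^ 2 + y ^ 2)
  set s := Real.sin (φ / 2)
  set c := Real.cos (φ / 2)
  clear_value D s c
  field_simp
  grind

/-- The map `(p, φ) ↦ capParam ρ φ p` on three-space. -/
def capMap (ρ : ℝ) (y : E3) : E3 := capParam ρ (y 2) !₂[y 0, y 1]

theorem hasFDerivAt_capMap (ρ : ℝ) (y : E3) (hD : capDen (y 2) (y 0 ^ 2 + y 1 ^ 2) ≠ 0) :
    HasFDerivAt (capMap ρ) (Matrix.toEuclideanCLM (𝕜 := ℝ) (capJac ρ (y 2) (y 0) (y 1))) y := by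
  have hX : ∀ i, HasFDerivAt (fun z : E3 => z i) (EuclideanSpace.proj i : E3 →L[ℝ] ℝ) y :=
    fun i => (EuclideanSpace.proj i : E3 →L[ℝ] ℝ).hasFDerivAt
  have hh := (hX 2).mul_const (1 / 2)
  have e : ∀ z : ℝ, z * (1 / 2) = z / 2 := fun z => by ring
  simp only [e] at hh
  have hs := hh.sin
  have hc := hh.cos
  have hP : HasFDerivAt (fun z : E3 => z 0 ^ 2 + z 1 ^ 2) _ y := ((hX 0).pow 2).add ((hX 1).pow 2)
  have hDen : HasFDerivAt (fun z : E3 => capDen (z 2) (z 0 ^ 2 + z 1 ^ 2)) _ y :=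
    (hc.pow 2).add ((hs.pow 2).mul hP)
  have hfac : HasFDerivAt (fun z : E3 => ρ / capDen (z 2) (z 0 ^ 2 + z 1 ^ 2)) _ y :=
    ((hasDerivAt_inv hD).comp_hasFDerivAt y hDen).const_mul ρ
  suffices H : ∀ i, HasFDerivAt (fun z : E3 => capMap ρ z i)
      ((EuclideanSpace.proj i : E3 →L[ℝ] ℝ).comp
        (Matrix.toEuclideanCLM (𝕜 := ℝ) (capJac ρ (y 2) (y 0) (y 1)))) y by
    rw [← hasFDerivWithinAt_univ, hasFDerivWithinAt_euclidean]
    exact fun i => (H i).hasFDerivWithinAt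
  intro i
  fin_cases i
  · refine HasFDerivAt.congr_of_eventuallyEq ((hfac.mul (hX 0)).congr_fderiv ?_)
      (Filter.Eventually.of_forall fun z => ?_)
    · ext v
      simp [capJac, Matrix.ofLp_toEuclideanCLM, Matrix.mulVec, dotProduct, Fin.sum_univ_three]
      field_simp
      ring
    · simp [capMap, capParam_zero, capDen]
  · refine HasFDerivAt.congr_of_eventuallyEq ((hfac.mul (hX 1)).congr_fderiv ?_)
      (Filter.Eventually.of_forall fun z => ?_)
    · ext v
      simp [capJac, Matrix.ofLp_toEuclideanCLM, Matrix.mulVec, dotProduct, Fin.sum_univ_three]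
      field_simp
      ring
    · simp [capMap, capParam_one, capDen]
  · refine HasFDerivAt.congr_of_eventuallyEq ((hfac.mul ((hs.mul hc).mul (hP.const_sub 1))).congr_fderiv ?_)
      (Filter.Eventually.of_forall fun z => ?_)
    · ext v
      simp [capJac, Matrix.ofLp_toEuclideanCLM, Matrix.mulVec, dotProduct, Fin.sum_univ_three]
      field_simp
      ring
    · simp [capMap, capParam_two, capDen]


/-- A cap is a slice φ = const of `capMap`, so its tangent vectors are the first two columns of
`capJac`. -/
theorem fderiv_capParam_single {ρ φ : ℝ} (h1 : -Real.pi < φ) (h2 : φ < Real.pi) (p : E2)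
    (i : Fin 2) (j : Fin 3) :
    fderiv ℝ (capParam ρ φ) p (EuclideanSpace.single i 1) j =
      capJac ρ φ (p 0) (p 1) j i.castSucc := by
  let L : E2 →L[ℝ] E3 := LinearMap.toContinuousLinearMap
    { toFun := fun q => !₂[q 0, q 1, 0]
      map_add' := fun x y => by ext k; fin_cases k <;> simp
      map_smul' := fun r x => by ext k; fin_cases k <;> simp }
  have hL : ∀ q : E2, L q = !₂[q 0, q 1, 0] := fun q => rfl
  have hι : ∀ q : E2, L q + !₂[0, 0, φ] = !₂[q 0, q 1, φ] := fun q => by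
    rw [hL]
    ext k
    fin_cases k <;> simp
  have hD : capDen ((L p + !₂[0, 0, φ]) 2)
      ((L p + !₂[0, 0, φ]) 0 ^ 2 + (L p + !₂[0, 0, φ]) 1 ^ 2) ≠ 0 := by
    rw [hι]
    exact (capDen_pos h1 h2 (by positivity)).ne'
  have h := (hasFDerivAt_capMap ρ _ hD).comp p (L.hasFDerivAt.add_const !₂[0, 0, φ])
  have hf : (capMap ρ ∘ fun q : E2 => L q + !₂[0, 0, φ]) = capParam ρ φ := by
    ext q : 1
    simp only [Function.comp, hι]
    unfold capMap
    congr 1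
    ext k
    fin_cases k <;> simp
  rw [hf] at h
  rw [h.fderiv, hι]
  simp only [ContinuousLinearMap.comp_apply, hL, Matrix.ofLp_toEuclideanCLM]
  fin_cases i <;> fin_cases j <;>
    simp [Matrix.mulVec, dotProduct, Fin.sum_univ_three]

/-- The parametrization is conformal: the two tangent vectors are orthogonal (`hab`) and have the
same squared length ρ²/D² (`ha`, `hb`). -/
theorem areaDensity_capParam {ρ φ : ℝ} (h1 : -Real.pi < φ) (h2 : φ < Real.pi) (p : E2) :
    areaDensity (capParam ρ φ) p = ρ ^ 2 / capDen φ (‖p‖ ^ 2) ^ 2 := by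
  have hD := (capDen_pos (P := p 0 ^ 2 + p 1 ^ 2) h1 h2 (by positivity)).ne'
  have hsc := Real.sin_sq_add_cos_sq (φ / 2)
  have hDd : capDen φ (p 0 ^ 2 + p 1 ^ 2) =
    Real.cos (φ / 2) ^ 2 + Real.sin (φ / 2) ^ 2 * (p 0 ^ 2 + p 1 ^ 2) := rfl
  dsimp only [areaDensity]
  rw [norm_sq_E3, norm_sq_E3, PiLp.inner_apply, Fin.sum_univ_three]
  simp only [fderiv_capParam_single h1 h2, RCLike.inner_apply, conj_trivial]
  rw [norm_sq_E2]
  rw [← Real.sqrt_sq (show 0 ≤ ρ ^ 2 / capDen φ (p 0 ^ 2 + p 1 ^ 2) ^ 2 by positivity)]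
  congr 1
  simp only [capJac, Fin.castSucc_zero, Fin.castSucc_one, Matrix.of_apply, Matrix.cons_val',
    Matrix.cons_val_zero, Matrix.cons_val_one, Matrix.cons_val, Matrix.cons_val_fin_one]
  set D := capDen φ (p 0 ^ 2 + p 1 ^ 2)
  set s := Real.sin (φ / 2)
  set c := Real.cos (φ / 2)
  generalize p 0 = x at *
  generalize p 1 = y at *
  clear_value D s c
  have hQ : D + s ^ 2 * (1 - (x ^ 2 + y ^ 2)) = 1 := by linear_combination hDd + hsc
  have h3 : ∀ z, -(2 * ρ * s * c * z / D) - 2 * ρ * s ^ 2 * z *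
      (s * c * (1 - (x ^ 2 + y ^ 2))) / D ^ 2 = -(2 * ρ * s * c * z / D ^ 2) := fun z => by
    field_simp
    linear_combination -(ρ * s * c * z) * hQ
  have ha : (ρ / D - 2 * ρ * s ^ 2 * x * x / D ^ 2) ^ 2 + (-(2 * ρ * s ^ 2 * x * y / D ^ 2)) ^ 2 +
      (-(2 * ρ * s * c * x / D ^ 2)) ^ 2 = ρ ^ 2 / D ^ 2 := by
    field_simp
    linear_combination -4 * ρ ^ 2 * s ^ 2 * x ^ 2 * hDd
  have hb : (-(2 * ρ * s ^ 2 * y * x / D ^ 2)) ^ 2 + (ρ / D - 2 * ρ * s ^ 2 * y * y / D ^ 2) ^ 2 +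
      (-(2 * ρ * s * c * y / D ^ 2)) ^ 2 = ρ ^ 2 / D ^ 2 := by
    field_simp
    linear_combination -4 * ρ ^ 2 * s ^ 2 * y ^ 2 * hDd
  have hab : -(2 * ρ * s ^ 2 * y * x / D ^ 2) * (ρ / D - 2 * ρ * s ^ 2 * x * x / D ^ 2) +
      (ρ / D - 2 * ρ * s ^ 2 * y * y / D ^ 2) * -(2 * ρ * s ^ 2 * x * y / D ^ 2) +
      -(2 * ρ * s * c * y / D ^ 2) * -(2 * ρ * s * c * x / D ^ 2) = 0 := by
    field_simp
    linear_combination -4 * ρ ^ 2 * s ^ 2 * x * y * hDd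
  rw [h3, h3, ha, hb, hab]
  ring

theorem conf_capParam {ρ φ : ℝ} (h1 : -Real.pi < φ) (h2 : φ < Real.pi) (p : E2) :
    conf (capParam ρ φ p) = 2 * capDen φ (‖p‖ ^ 2) /
      ((Real.cos (φ / 2) ^ 2 - ρ ^ 2 * Real.sin (φ / 2) ^ 2) +
        (Real.sin (φ / 2) ^ 2 - ρ ^ 2 * Real.cos (φ / 2) ^ 2) * ‖p‖ ^ 2) := by
  obtain ⟨hD, e1, -⟩ := capParam_coords (ρ := ρ) h1 h2 p
  have hcos : Real.cos φ = Real.cos (φ / 2) ^ 2 - Real.sin (φ / 2) ^ 2 := by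
    rw [← Real.cos_two_mul', show 2 * (φ / 2) = φ by ring]
  have hsc := Real.sin_sq_add_cos_sq (φ / 2)
  have e : 1 - ‖capParam ρ φ p‖ ^ 2 =
      ((Real.cos (φ / 2) ^ 2 - ρ ^ 2 * Real.sin (φ / 2) ^ 2) +
        (Real.sin (φ / 2) ^ 2 - ρ ^ 2 * Real.cos (φ / 2) ^ 2) * ‖p‖ ^ 2) /
        capDen φ (‖p‖ ^ 2) := by
    rw [show 1 - ‖capParam ρ φ p‖ ^ 2 = 1 - ρ ^ 2 + (ρ ^ 2 - ‖capParam ρ φ p‖ ^ 2) by ring, e1,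
      hcos]
    unfold capDen
    field_simp
    grind
  rw [conf, e, div_div_eq_mul_div]

/-! ### Radial integrals over the disc, the area of a cap, and caps inside the ball. -/

theorem measure_ball_E2 : (MeasureTheory.volume : MeasureTheory.Measure E2).real
    (Metric.ball 0 1) = Real.pi := by
  rw [MeasureTheory.measureReal_def, EuclideanSpace.volume_ball_fin_two]
  simp [Real.pi_pos.le]

/-- Integration of a radial function over the unit disc. -/
theorem integral_disc {f H : ℝ → ℝ} (hH : ∀ u ∈ Set.Icc (0 : ℝ) 1, HasDerivAt H (f u) u)
    (hf : ContinuousOn f (Set.Icc 0 1)) :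
    ∫ p in Metric.ball (0 : E2) 1, f (‖p‖ ^ 2) = Real.pi * (H 1 - H 0) := by
  have h1 : ∫ p in Metric.ball (0 : E2) 1, f (‖p‖ ^ 2) =
      ∫ p : E2, (Set.Iio (1 : ℝ)).indicator (fun y => f (y ^ 2)) ‖p‖ := by
    rw [← MeasureTheory.integral_indicator Metric.isOpen_ball.measurableSet]
    congr 1
    ext p
    simp [Set.indicator]
  rw [h1, MeasureTheory.integral_fun_norm_addHaar, finrank_euclideanSpace_fin, measure_ball_E2]
  have h2 : ∫ y in Set.Ioi (0 : ℝ), y ^ (2 - 1) • (Set.Iio (1 : ℝ)).indicator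
      (fun y => f (y ^ 2)) y = ∫ y in (0 : ℝ)..1, y * f (y ^ 2) := by
    rw [intervalIntegral.integral_of_le zero_le_one, MeasureTheory.integral_Ioc_eq_integral_Ioo,
      ← MeasureTheory.integral_indicator measurableSet_Ioi,
      ← MeasureTheory.integral_indicator measurableSet_Ioo]
    congr 1
    ext y
    by_cases h : 0 < y <;> by_cases h' : y < 1 <;> simp [Set.indicator, h, h']
  have hmem : ∀ y ∈ Set.uIcc (0 : ℝ) 1, y ^ 2 ∈ Set.Icc (0 : ℝ) 1 := fun y hy => by
    rw [Set.uIcc_of_le zero_le_one] at hy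
    exact ⟨by positivity, by nlinarith [hy.1, hy.2]⟩
  have h3 : ∫ y in (0 : ℝ)..1, y * f (y ^ 2) = (H 1 - H 0) / 2 := by
    rw [intervalIntegral.integral_eq_sub_of_hasDerivAt (f := fun y => H (y ^ 2) / 2)]
    · norm_num
      ring
    · intro y hy
      have := (HasDerivAt.comp (h₂ := H) (h := fun x => x ^ 2) y (hH _ (hmem y hy))
        (hasDerivAt_pow 2 y)).div_const 2
      refine this.congr_deriv ?_
      simp
      ring
    · apply ContinuousOn.intervalIntegrable
      exact continuousOn_id.mul (hf.comp (by fun_prop) hmem)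
  rw [h2, h3]
  simp
  ring

theorem integrableOn_disc {f : ℝ → ℝ} (hf : ContinuousOn f (Set.Icc 0 1)) :
    MeasureTheory.IntegrableOn (fun p : E2 => f (‖p‖ ^ 2)) (Metric.ball 0 1) := by
  refine MeasureTheory.IntegrableOn.mono_set (t := Metric.closedBall 0 1) ?_
    Metric.ball_subset_closedBall
  refine ContinuousOn.integrableOn_compact (isCompact_closedBall _ _) (hf.comp (by fun_prop) ?_)
  intro p hp
  have : ‖p‖ ≤ 1 := by simpa using hp
  exact ⟨by positivity, by nlinarith [norm_nonneg p]⟩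

/-- The hyperbolic cosine of the hyperbolic radius of the circle of Euclidean radius `ρ`. -/
def ch (ρ : ℝ) : ℝ := (1 + ρ ^ 2) / (1 - ρ ^ 2)

/-- The hyperbolic sine of the hyperbolic radius of the circle of Euclidean radius `ρ`. -/
def sh (ρ : ℝ) : ℝ := 2 * ρ / (1 - ρ ^ 2)

theorem one_sub_sq_pos {ρ : ℝ} (h0 : 0 < ρ) (h1 : ρ < 1) : 0 < 1 - ρ ^ 2 := by nlinarith

theorem one_lt_ch {ρ : ℝ} (h0 : 0 < ρ) (h1 : ρ < 1) : 1 < ch ρ := by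
  have h := one_sub_sq_pos h0 h1
  rw [ch, lt_div_iff₀ h]
  nlinarith

theorem sh_pos {ρ : ℝ} (h0 : 0 < ρ) (h1 : ρ < 1) : 0 < sh ρ := by
  have h := one_sub_sq_pos h0 h1
  unfold sh
  positivity

theorem sh_sq {ρ : ℝ} (h0 : 0 < ρ) (h1 : ρ < 1) : sh ρ ^ 2 = ch ρ ^ 2 - 1 := by
  have h := one_sub_sq_pos h0 h1
  unfold sh ch
  field_simp
  ring

/-- The denominator of the conformal factor in `conf_capParam` is affine in u = ‖p‖². This is its
value at u = 0, the top of the cap; at u = 1, the bounding circle, it is 1 − ρ² (`radial_den_one`).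
Positivity at both ends gives positivity on the whole cap. -/
theorem half_angle_sub {ρ : ℝ} (h0 : 0 < ρ) (h1 : ρ < 1) (φ : ℝ) :
    Real.cos (φ / 2) ^ 2 - ρ ^ 2 * Real.sin (φ / 2) ^ 2 =
      (1 - ρ ^ 2) * (1 + ch ρ * Real.cos φ) / 2 := by
  have h := one_sub_sq_pos h0 h1
  have hcos : Real.cos φ = Real.cos (φ / 2) ^ 2 - Real.sin (φ / 2) ^ 2 := by
    rw [← Real.cos_two_mul', show 2 * (φ / 2) = φ by ring]
  have hsc := Real.sin_sq_add_cos_sq (φ / 2)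
  rw [hcos, ch]
  field_simp
  grind

theorem radial_den_pos {k₀ k₁ u : ℝ} (hk : 0 < k₀) (hk1 : 0 < k₀ + k₁) (hu : u ∈ Set.Icc (0 : ℝ) 1) :
    0 < k₀ + k₁ * u := by
  obtain ⟨h0, h1⟩ := hu
  rcases h1.lt_or_eq with h | rfl
  · nlinarith [mul_pos hk (sub_pos.mpr h), mul_nonneg hk1.le h0]
  · simpa using hk1

/-- The factors `capDen` cancel between the conformal factor and the area density, which leaves
4ρ²/(k₀ + k₁u)², with a rational antiderivative in u. -/
theorem capArea_eq {ρ φ : ℝ} (h0 : 0 < ρ) (hρ : ρ < 1) (h1 : -Real.pi < φ) (h2 : φ < Real.pi)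
    (hk : 0 < 1 + ch ρ * Real.cos φ) :
    capArea ρ φ = 2 * Real.pi * sh ρ ^ 2 / (1 + ch ρ * Real.cos φ) := by
  have h := one_sub_sq_pos h0 hρ
  have e0 := half_angle_sub h0 hρ φ
  have hsc := Real.sin_sq_add_cos_sq (φ / 2)
  set k₀ := Real.cos (φ / 2) ^ 2 - ρ ^ 2 * Real.sin (φ / 2) ^ 2 with hk0
  set k₁ := Real.sin (φ / 2) ^ 2 - ρ ^ 2 * Real.cos (φ / 2) ^ 2 with hk1
  have hs : k₀ + k₁ = 1 - ρ ^ 2 := by linear_combination (1 - ρ ^ 2) * hsc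
  have k0pos : 0 < k₀ := by rw [e0]; positivity
  have kspos : 0 < k₀ + k₁ := by rw [hs]; exact h
  have hint : ∀ p ∈ Metric.ball (0 : E2) 1,
      conf (capParam ρ φ p) ^ 2 * areaDensity (capParam ρ φ) p =
        4 * ρ ^ 2 / (k₀ + k₁ * ‖p‖ ^ 2) ^ 2 := by
    intro p hp
    have hp1 : ‖p‖ < 1 := by simpa using hp
    have hq := radial_den_pos k0pos kspos (u := ‖p‖ ^ 2)
      ⟨by positivity, by nlinarith [norm_nonneg p]⟩
    have hD := capDen_pos (P := ‖p‖ ^ 2) h1 h2 (by positivity)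
    rw [conf_capParam h1 h2, areaDensity_capParam h1 h2, ← hk0, ← hk1]
    field_simp
    norm_num
  rw [capArea, hypArea, MeasureTheory.setIntegral_congr_fun Metric.isOpen_ball.measurableSet hint]
  refine (integral_disc (f := fun u => 4 * ρ ^ 2 / (k₀ + k₁ * u) ^ 2)
    (H := fun u => 4 * ρ ^ 2 * u / (k₀ * (k₀ + k₁ * u))) ?_ ?_).trans ?_
  rotate_left 2
  · simp only [mul_one, mul_zero, add_zero, zero_div, sub_zero]
    rw [hs, e0, sh]
    field_simp
    norm_num
  · intro u hu
    have hq := radial_den_pos k0pos kspos hu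
    have := ((hasDerivAt_id u).const_mul (4 * ρ ^ 2)).div
      ((((hasDerivAt_id u).const_mul k₁).const_add k₀).const_mul k₀)
      (by simpa using ⟨k0pos.ne', hq.ne'⟩)
    refine this.congr_deriv ?_
    simp only [id]
    field_simp
    ring
  · intro u hu
    have hq := radial_den_pos k0pos kspos hu
    apply ContinuousAt.continuousWithinAt
    have : (k₀ + k₁ * u) ^ 2 ≠ 0 := by positivity
    fun_prop (disch := assumption)

theorem radial_den_one {ρ : ℝ} (φ : ℝ) :
    (Real.cos (φ / 2) ^ 2 - ρ ^ 2 * Real.sin (φ / 2) ^ 2) +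
      (Real.sin (φ / 2) ^ 2 - ρ ^ 2 * Real.cos (φ / 2) ^ 2) = 1 - ρ ^ 2 := by
  linear_combination (1 - ρ ^ 2) * Real.sin_sq_add_cos_sq (φ / 2)

/-- A cap lies in the open unit ball if and only if its top does. -/
theorem cap_subset_H3_iff {ρ φ : ℝ} (h0 : 0 < ρ) (hρ : ρ < 1) (h1 : -Real.pi < φ)
    (h2 : φ < Real.pi) : cap ρ φ ⊆ H3 ↔ 0 < 1 + ch ρ * Real.cos φ := by
  have h := one_sub_sq_pos h0 hρ
  have e0 := half_angle_sub h0 hρ φ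
  have hs := radial_den_one (ρ := ρ) φ
  have hmem : ∀ p ∈ Metric.ball (0 : E2) 1, capParam ρ φ p ∈ H3 ↔
      0 < (Real.cos (φ / 2) ^ 2 - ρ ^ 2 * Real.sin (φ / 2) ^ 2) +
        (Real.sin (φ / 2) ^ 2 - ρ ^ 2 * Real.cos (φ / 2) ^ 2) * ‖p‖ ^ 2 := by
    intro p hp
    have hc := conf_capParam (ρ := ρ) h1 h2 p
    have hD := capDen_pos (P := ‖p‖ ^ 2) h1 h2 (by positivity)
    have hn : capParam ρ φ p ∈ H3 ↔ 0 < conf (capParam ρ φ p) := by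
      simp only [H3, mem_ball_zero_iff, conf]
      constructor
      · intro hlt
        have : 0 < 1 - ‖capParam ρ φ p‖ ^ 2 := by nlinarith [norm_nonneg (capParam ρ φ p)]
        positivity
      · intro hpos
        have : 0 < 1 - ‖capParam ρ φ p‖ ^ 2 := (div_pos_iff_of_pos_left two_pos).1 hpos
        nlinarith [norm_nonneg (capParam ρ φ p)]
    rw [hn, hc, div_pos_iff_of_pos_left (by positivity)]
  rw [← (capParam_bijOn h0 h1 h2).image_eq, Set.image_subset_iff]
  constructor
  · intro hsub
    have h00 := (hmem 0 (by simp)).1 (hsub (by simp : (0 : E2) ∈ Metric.ball 0 1))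
    rw [norm_zero, e0] at h00
    norm_num at h00
    exact (mul_pos_iff_of_pos_left h).1 h00
  · intro hk p hp
    have hp1 : ‖p‖ < 1 := by simpa using hp
    refine (hmem p hp).2 (radial_den_pos (by rw [e0]; positivity) (by rw [hs]; exact h)
      ⟨by positivity, by nlinarith [norm_nonneg p]⟩)

/-! ### Volume of the region between two caps. -/

/-- The hyperbolic volume element on the disc in the coordinates `(p, φ)`. -/
def volDensity (ρ φ u : ℝ) : ℝ :=
  4 * ρ ^ 3 * (1 - u) / ((Real.cos (φ / 2) ^ 2 - ρ ^ 2 * Real.sin (φ / 2) ^ 2) +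
    (Real.sin (φ / 2) ^ 2 - ρ ^ 2 * Real.cos (φ / 2) ^ 2) * u) ^ 3

theorem lintegral_disc_volDensity {ρ φ : ℝ} (h0 : 0 < ρ) (hρ : ρ < 1)
    (hk : 0 < 1 + ch ρ * Real.cos φ) :
    ∫⁻ p in Metric.ball (0 : E2) 1, ENNReal.ofReal (volDensity ρ φ (‖p‖ ^ 2)) =
      ENNReal.ofReal (Real.pi * sh ρ ^ 3 / (1 + ch ρ * Real.cos φ) ^ 2) := by
  have h := one_sub_sq_pos h0 hρ
  have e0 := half_angle_sub h0 hρ φ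
  have hs := radial_den_one (ρ := ρ) φ
  unfold volDensity
  set k₀ := Real.cos (φ / 2) ^ 2 - ρ ^ 2 * Real.sin (φ / 2) ^ 2
  set k₁ := Real.sin (φ / 2) ^ 2 - ρ ^ 2 * Real.cos (φ / 2) ^ 2
  have k0pos : 0 < k₀ := by rw [e0]; positivity
  have kspos : 0 < k₀ + k₁ := by rw [hs]; exact h
  have hcont : ContinuousOn (fun u => 4 * ρ ^ 3 * (1 - u) / (k₀ + k₁ * u) ^ 3)
      (Set.Icc 0 1) := by
    intro u hu
    have hq := radial_den_pos k0pos kspos hu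
    apply ContinuousAt.continuousWithinAt
    have : (k₀ + k₁ * u) ^ 3 ≠ 0 := by positivity
    fun_prop (disch := assumption)
  rw [← MeasureTheory.ofReal_integral_eq_lintegral_ofReal (integrableOn_disc hcont)]
  · congr 1
    refine (integral_disc (f := fun u => 4 * ρ ^ 3 * (1 - u) / (k₀ + k₁ * u) ^ 3)
      -- This antiderivative vanishes at u = 1, so only its value at the top of the cap, u = 0,
      -- contributes.
      (H := fun u => -(2 * ρ ^ 3 * (1 - u) ^ 2) / ((k₀ + k₁) * (k₀ + k₁ * u) ^ 2)) ?_ hcont).trans ?_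
    · intro u hu
      have hq := radial_den_pos k0pos kspos hu
      have := (((((hasDerivAt_id u).const_sub 1).pow 2).const_mul (2 * ρ ^ 3)).neg).div
        (((((hasDerivAt_id u).const_mul k₁).const_add k₀).pow 2).const_mul (k₀ + k₁))
        (by simpa using ⟨kspos.ne', hq.ne'⟩)
      refine this.congr_deriv ?_
      simp only [id]
      simp
      field_simp
      ring
    · rw [hs, e0, sh]
      field_simp
      norm_num
      ring
  · filter_upwards [MeasureTheory.ae_restrict_mem Metric.isOpen_ball.measurableSet] with p hp
    have hp1 : ‖p‖ < 1 := by simpa using hp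
    have hu : 0 < 1 - ‖p‖ ^ 2 := by nlinarith [norm_nonneg p]
    have hq := radial_den_pos k0pos kspos (u := ‖p‖ ^ 2) ⟨by positivity, by linarith⟩
    show 0 ≤ 4 * ρ ^ 3 * (1 - ‖p‖ ^ 2) / (k₀ + k₁ * ‖p‖ ^ 2) ^ 3
    positivity

/-- Three-space as the product of the vertical line and the horizontal plane. -/
def splitE3 (y : E3) : ℝ × E2 := (y 2, !₂[y 0, y 1])

theorem measurePreserving_splitE3 : MeasureTheory.MeasurePreserving splitE3 := by
  have h := (((MeasureTheory.MeasurePreserving.id (MeasureTheory.volume : MeasureTheory.Measure ℝ)).prod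
    (PiLp.volume_preserving_toLp (Fin 2))).comp
    (MeasureTheory.volume_preserving_piFinSuccAbove (fun _ : Fin 3 => ℝ) 2)).comp
    (PiLp.volume_preserving_ofLp (Fin 3))
  convert h using 1
  · ext y : 1
    simp only [splitE3, Function.comp]
    refine Prod.ext rfl ?_
    ext k
    fin_cases k <;> rfl
  · exact MeasureTheory.Measure.volume_eq_prod _ _

theorem splitE3_normSq (y : E3) : ‖(splitE3 y).2‖ ^ 2 = y 0 ^ 2 + y 1 ^ 2 := by
  simp [splitE3, norm_sq_E2]

theorem ae_two_ne_zero : ∀ᵐ x : E3, x 2 ≠ 0 := by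
  have h : MeasureTheory.Measure.QuasiMeasurePreserving (fun y : E3 => y 2) :=
    MeasureTheory.Measure.quasiMeasurePreserving_fst.comp
      measurePreserving_splitE3.quasiMeasurePreserving
  exact h.ae (MeasureTheory.Measure.ae_ne MeasureTheory.volume 0)

/-- Change of variables along `capMap`, then Tonelli: the Jacobian determinant times the cube of the
conformal factor is `volDensity`, and the inner integral over the disc is
`lintegral_disc_volDensity`. -/
theorem hypVol_region {ρ a b : ℝ} (h0 : 0 < ρ) (hρ : ρ < 1) (ha : -Real.pi < a) (hab : a ≤ b)
    (hb : b < Real.pi) (hk : ∀ φ ∈ Set.Icc a b, 0 < 1 + ch ρ * Real.cos φ) :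
    hypVol {x | a < capAngle ρ x ∧ capAngle ρ x < b} =
      ENNReal.ofReal (∫ φ in a..b, Real.pi * sh ρ ^ 3 / (1 + ch ρ * Real.cos φ) ^ 2) := by
  set S : Set E3 := splitE3 ⁻¹' (Set.Ioo a b ×ˢ Metric.ball 0 1) with hS
  have hSm : MeasurableSet S := measurePreserving_splitE3.measurable
    (measurableSet_Ioo.prod Metric.isOpen_ball.measurableSet)
  have hSmem : ∀ y ∈ S, a < y 2 ∧ y 2 < b ∧ (!₂[y 0, y 1] : E2) ∈ Metric.ball 0 1 :=
    fun y hy => ⟨hy.1.1, hy.1.2, hy.2⟩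
  have hinj : Set.InjOn (capMap ρ) S := by
    intro x hx y hy hxy
    obtain ⟨a1, a2, a3⟩ := hSmem x hx
    obtain ⟨b1, b2, b3⟩ := hSmem y hy
    have c1 := ((capParam_bijOn h0 (by linarith : -Real.pi < x 2) (by linarith)).mapsTo a3).2
    have c2 := ((capParam_bijOn h0 (by linarith : -Real.pi < y 2) (by linarith)).mapsTo b3).2
    unfold capMap at hxy
    rw [hxy, c2] at c1
    rw [c1] at hxy
    have d := (capParam_bijOn h0 (by linarith : -Real.pi < x 2) (by linarith)).injOn a3 b3 hxy
    have d0 := congrArg (fun z : E2 => z 0) d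
    have d1 := congrArg (fun z : E2 => z 1) d
    ext k
    fin_cases k
    · simpa using d0
    · simpa using d1
    · exact c1.symm
  have hsub : capMap ρ '' S ⊆ {x | a < capAngle ρ x ∧ capAngle ρ x < b} := by
    rintro _ ⟨y, hy, rfl⟩
    obtain ⟨a1, a2, a3⟩ := hSmem y hy
    have c1 := ((capParam_bijOn h0 (by linarith : -Real.pi < y 2) (by linarith)).mapsTo a3).2
    exact ⟨by rwa [capMap, c1], by rwa [capMap, c1]⟩
  -- On the bounding circle `capAngle` has the value `arg 0 = 0`, so the circle may satisfy the
  -- angle condition although no cap contains it. Discarding the null plane x₂ = 0 removes it.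
  have hsup : ∀ x : E3, x 2 ≠ 0 → a < capAngle ρ x ∧ capAngle ρ x < b → x ∈ capMap ρ '' S := by
    rintro x hx ⟨hxa, hxb⟩
    have hxc : x ∈ cap ρ (capAngle ρ x) := ⟨fun h => hx h.1, rfl⟩
    rw [← (capParam_bijOn h0 (by linarith) (by linarith)).image_eq] at hxc
    obtain ⟨p, hp, hpx⟩ := hxc
    have e : (!₂[p 0, p 1] : E2) = p := by
      ext k
      fin_cases k <;> rfl
    refine ⟨!₂[p 0, p 1, capAngle ρ x], ?_, ?_⟩
    · refine ⟨⟨hxa, hxb⟩, ?_⟩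
      simpa [splitE3, e] using hp
    · simpa [capMap, e] using hpx
  have hIm : capMap ρ '' S ⊆ H3 := by
    rintro _ ⟨y, hy, rfl⟩
    obtain ⟨a1, a2, a3⟩ := hSmem y hy
    exact (cap_subset_H3_iff h0 hρ (by linarith) (by linarith)).2 (hk _ ⟨a1.le, a2.le⟩)
      ((capParam_bijOn h0 (by linarith : -Real.pi < y 2) (by linarith)).mapsTo a3)
  have hder : ∀ y ∈ S, HasFDerivWithinAt (capMap ρ)
      (Matrix.toEuclideanCLM (𝕜 := ℝ) (capJac ρ (y 2) (y 0) (y 1))) S y := by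
    intro y hy
    obtain ⟨a1, a2, a3⟩ := hSmem y hy
    exact (hasFDerivAt_capMap ρ y (capDen_pos (by linarith) (by linarith)
      (by positivity)).ne').hasFDerivWithinAt
  have hImm : MeasurableSet (capMap ρ '' S) :=
    MeasureTheory.measurable_image_of_fderivWithin hSm hder hinj
  have hae : ({x | a < capAngle ρ x ∧ capAngle ρ x < b} : Set E3) =ᵐ[MeasureTheory.volume]
      capMap ρ '' S := by
    filter_upwards [ae_two_ne_zero] with x hx
    exact propext ⟨fun h => hsup x hx h, fun h => hsub h⟩
  have hac : hypVol.AbsolutelyContinuous MeasureTheory.volume :=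
    (MeasureTheory.withDensity_absolutelyContinuous _ _).trans
      MeasureTheory.Measure.absolutelyContinuous_restrict
  rw [MeasureTheory.measure_congr (hac.ae_eq hae), hypVol, MeasureTheory.withDensity_apply _ hImm,
    MeasureTheory.Measure.restrict_restrict hImm, Set.inter_eq_self_of_subset_left hIm,
    MeasureTheory.lintegral_image_eq_lintegral_abs_det_fderiv_mul MeasureTheory.volume hSm hder hinj]
  have hint : ∀ y ∈ S, ENNReal.ofReal
      |(Matrix.toEuclideanCLM (𝕜 := ℝ) (capJac ρ (y 2) (y 0) (y 1))).det| *
        ENNReal.ofReal (conf (capMap ρ y) ^ 3) =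
      (fun z : ℝ × E2 => ENNReal.ofReal (volDensity ρ z.1 (‖z.2‖ ^ 2))) (splitE3 y) := by
    intro y hy
    obtain ⟨a1, a2, a3⟩ := hSmem y hy
    have hp1 : ‖(!₂[y 0, y 1] : E2)‖ < 1 := by simpa using a3
    have hn : ‖(!₂[y 0, y 1] : E2)‖ ^ 2 = y 0 ^ 2 + y 1 ^ 2 := by simp [norm_sq_E2]
    have hu : 0 < 1 - (y 0 ^ 2 + y 1 ^ 2) := by
      rw [← hn]
      nlinarith [norm_nonneg (!₂[y 0, y 1] : E2)]
    have hD := capDen_pos (φ := y 2) (P := y 0 ^ 2 + y 1 ^ 2) (by linarith) (by linarith)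
      (by positivity)
    have hq := radial_den_pos (k₀ := Real.cos (y 2 / 2) ^ 2 - ρ ^ 2 * Real.sin (y 2 / 2) ^ 2)
      (k₁ := Real.sin (y 2 / 2) ^ 2 - ρ ^ 2 * Real.cos (y 2 / 2) ^ 2)
      (u := y 0 ^ 2 + y 1 ^ 2)
      (by
        rw [half_angle_sub h0 hρ]
        have := one_sub_sq_pos h0 hρ
        have := hk _ ⟨a1.le, a2.le⟩
        positivity)
      (by rw [radial_den_one]; exact one_sub_sq_pos h0 hρ) ⟨by positivity, by linarith⟩
    have hdet : (Matrix.toEuclideanCLM (𝕜 := ℝ) (capJac ρ (y 2) (y 0) (y 1))).det =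
        (capJac ρ (y 2) (y 0) (y 1)).det := by
      rw [ContinuousLinearMap.det, Matrix.coe_toEuclideanCLM_eq_toEuclideanLin]
      exact LinearMap.det_toLpLin _ _
    rw [hdet, det_capJac hD.ne', abs_of_nonneg (by positivity), ← ENNReal.ofReal_mul (by positivity)]
    simp only [splitE3_normSq]
    congr 1
    rw [capMap, conf_capParam (by linarith) (by linarith), hn, volDensity]
    simp only [splitE3]
    field_simp
    norm_num
  rw [MeasureTheory.setLIntegral_congr_fun hSm hint]
  have hvm : Measurable fun z : ℝ × E2 => ENNReal.ofReal (volDensity ρ z.1 (‖z.2‖ ^ 2)) := by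
    unfold volDensity
    fun_prop
  rw [hS, measurePreserving_splitE3.setLIntegral_comp_preimage
    (measurableSet_Ioo.prod Metric.isOpen_ball.measurableSet) hvm,
    MeasureTheory.Measure.volume_eq_prod, MeasureTheory.setLIntegral_prod _ hvm.aemeasurable]
  have hcont : ContinuousOn (fun φ => Real.pi * sh ρ ^ 3 / (1 + ch ρ * Real.cos φ) ^ 2)
      (Set.Icc a b) := by
    intro φ hφ
    have : (1 + ch ρ * Real.cos φ) ^ 2 ≠ 0 := by
      have := hk φ hφ
      positivity
    apply ContinuousAt.continuousWithinAt
    fun_prop (disch := assumption)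
  rw [intervalIntegral.integral_of_le hab, MeasureTheory.integral_Ioc_eq_integral_Ioo,
    MeasureTheory.ofReal_integral_eq_lintegral_ofReal]
  · exact MeasureTheory.setLIntegral_congr_fun measurableSet_Ioo fun φ hφ =>
      lintegral_disc_volDensity h0 hρ (hk φ ⟨hφ.1.le, hφ.2.le⟩)
  · exact (hcont.integrableOn_compact isCompact_Icc).mono_set Set.Ioo_subset_Icc_self
  · filter_upwards with φ
    have := sh_pos h0 hρ
    have := Real.pi_pos
    positivity

/-! ### The antiderivative of the volume density. -/

theorem ch_ge_one {ρ : ℝ} (h0 : 0 ≤ ρ) (h1 : ρ < 1) : 1 ≤ ch ρ := by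
  rcases h0.eq_or_lt with rfl | h
  · simp [ch]
  · exact (one_lt_ch h h1).le

/-- The two factors are exchanged by φ ↦ −φ. Hence the quotient inside the logarithm of `capPrim` is
inverted by this reflection, which makes `capPrim` odd; the identity also yields the sign of each
factor. -/
theorem capNum_mul (ρ φ : ℝ) (hs : sh ρ ^ 2 = ch ρ ^ 2 - 1) :
    (ch ρ + Real.cos φ + sh ρ * Real.sin φ) * (ch ρ + Real.cos φ - sh ρ * Real.sin φ) =
      (1 + ch ρ * Real.cos φ) ^ 2 := by
  linear_combination (-Real.sin φ ^ 2) * hs + (1 - ch ρ ^ 2) * Real.sin_sq_add_cos_sq φ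

theorem sh_sq' {ρ : ℝ} (h0 : 0 ≤ ρ) (h1 : ρ < 1) : sh ρ ^ 2 = ch ρ ^ 2 - 1 := by
  rcases h0.eq_or_lt with rfl | h
  · simp [ch, sh]
  · exact sh_sq h h1

theorem sh_nonneg {ρ : ℝ} (h0 : 0 ≤ ρ) (h1 : ρ < 1) : 0 ≤ sh ρ := by
  rcases h0.eq_or_lt with rfl | h
  · simp [sh]
  · exact (sh_pos h h1).le

theorem capNum_pos {ρ φ : ℝ} (h0 : 0 ≤ ρ) (h1 : ρ < 1) (hk : 0 < 1 + ch ρ * Real.cos φ) :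
    0 < ch ρ + Real.cos φ + sh ρ * Real.sin φ := by
  have hm := capNum_mul ρ φ (sh_sq' h0 h1)
  have hc := ch_ge_one h0 h1
  have hs := sh_nonneg h0 h1
  have hcos := Real.neg_one_le_cos φ
  have hp : 0 < (1 + ch ρ * Real.cos φ) ^ 2 := by positivity
  rw [← hm] at hp
  -- The sign of sin φ decides which of the two factors is visibly nonnegative; the positive product
  -- then settles the claim.
  rcases le_or_gt 0 (Real.sin φ) with h | h
  · have : 0 ≤ sh ρ * Real.sin φ := by positivity
    have h2 : 0 ≤ ch ρ + Real.cos φ + sh ρ * Real.sin φ := by linarith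
    exact h2.lt_of_ne fun h3 => by rw [← h3, zero_mul] at hp; exact hp.false
  · have : 0 ≤ sh ρ * -Real.sin φ := mul_nonneg hs (by linarith)
    exact pos_of_mul_pos_left hp (by linarith)

/-- The hyperbolic volume, divided by `π`, of the lens between the flat disc and the cap
`cap ρ φ`. -/
def capPrim (ρ φ : ℝ) : ℝ :=
  sh ρ * ch ρ * Real.sin φ / (1 + ch ρ * Real.cos φ) -
    Real.log ((ch ρ + Real.cos φ + sh ρ * Real.sin φ) / (1 + ch ρ * Real.cos φ))

theorem hasDerivAt_capPrim {ρ φ : ℝ} (h0 : 0 ≤ ρ) (h1 : ρ < 1)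
    (hk : 0 < 1 + ch ρ * Real.cos φ) :
    HasDerivAt (capPrim ρ) (sh ρ ^ 3 / (1 + ch ρ * Real.cos φ) ^ 2) φ := by
  have hN := capNum_pos h0 h1 hk
  have hs := sh_sq' h0 h1
  have hD := ((Real.hasDerivAt_cos φ).const_mul (ch ρ)).const_add 1
  have hNd := ((Real.hasDerivAt_cos φ).const_add (ch ρ)).add
    ((Real.hasDerivAt_sin φ).const_mul (sh ρ))
  have hl := (hNd.div hD hk.ne').log (div_pos hN hk).ne'
  have h := ((((Real.hasDerivAt_sin φ).const_mul (sh ρ * ch ρ)).div hD hk.ne').sub hl)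
  refine h.congr_deriv ?_
  have hsc := Real.sin_sq_add_cos_sq φ
  simp only [Pi.add_apply, Pi.div_apply]
  set S := sh ρ
  set C := ch ρ
  set s := Real.sin φ
  set c := Real.cos φ
  have e1 : S * C * c * (1 + C * c) - S * C * s * (C * -s) = S * C * (C + c) := by
    linear_combination S * C ^ 2 * hsc
  have e2 : (-s + S * c) * (1 + C * c) - (C + c + S * s) * (C * -s) = S * (C + c + S * s) := by
    linear_combination S * C * hsc - s * hs
  rw [e1, e2]
  field_simp
  linear_combination (-S) * hs

theorem capPrim_neg {ρ φ : ℝ} (h0 : 0 ≤ ρ) (h1 : ρ < 1) (hk : 0 < 1 + ch ρ * Real.cos φ) :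
    capPrim ρ (-φ) = -capPrim ρ φ := by
  have hN := capNum_pos h0 h1 hk
  have hm := capNum_mul ρ φ (sh_sq' h0 h1)
  have e : (ch ρ + Real.cos φ - sh ρ * Real.sin φ) / (1 + ch ρ * Real.cos φ) =
      ((ch ρ + Real.cos φ + sh ρ * Real.sin φ) / (1 + ch ρ * Real.cos φ))⁻¹ := by
    field_simp
    linear_combination hm
  unfold capPrim
  rw [Real.cos_neg, Real.sin_neg, mul_neg (sh ρ) (Real.sin φ), ← sub_eq_add_neg, e, Real.log_inv]
  ring

theorem capPrim_zero_left {φ : ℝ} (hk : 0 < 1 + Real.cos φ) : capPrim 0 φ = 0 := by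
  simp [capPrim, ch, sh, hk.ne']

theorem continuousAt_capPrim {ρ φ : ℝ} (h0 : 0 ≤ ρ) (h1 : ρ < 1)
    (hk : 0 < 1 + ch ρ * Real.cos φ) :
    ContinuousAt (fun x : ℝ × ℝ => capPrim x.1 x.2) (ρ, φ) := by
  have hN := capNum_pos h0 h1 hk
  have hρ : 1 - ρ ^ 2 ≠ 0 := by nlinarith
  have hch : ContinuousAt (fun x : ℝ × ℝ => ch x.1) (ρ, φ) := by
    unfold ch
    exact ContinuousAt.div (by fun_prop) (by fun_prop) hρ
  have hsh : ContinuousAt (fun x : ℝ × ℝ => sh x.1) (ρ, φ) := by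
    unfold sh
    exact ContinuousAt.div (by fun_prop) (by fun_prop) hρ
  unfold capPrim
  have hD : ContinuousAt (fun x : ℝ × ℝ => 1 + ch x.1 * Real.cos x.2) (ρ, φ) := by fun_prop
  have hNc : ContinuousAt (fun x : ℝ × ℝ => ch x.1 + Real.cos x.2 + sh x.1 * Real.sin x.2)
    (ρ, φ) := by fun_prop
  exact (ContinuousAt.div (by fun_prop) hD hk.ne').sub
    ((hNc.div hD hk.ne').log (div_pos hN hk).ne')

/-! ### Admissible parameters, monotonicity of the volumes, uniqueness of the bubble. -/

theorem den_pos_iff {ρ : ℝ} (h0 : 0 ≤ ρ) (h1 : ρ < 1) (φ : ℝ) :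
    0 < 1 + ch ρ * Real.cos φ ↔ ρ ^ 2 * (1 - Real.cos φ) < 1 + Real.cos φ := by
  have h : 0 < 1 - ρ ^ 2 := by nlinarith
  have e : 1 + ch ρ * Real.cos φ = (1 + Real.cos φ - ρ ^ 2 * (1 - Real.cos φ)) / (1 - ρ ^ 2) := by
    unfold ch
    field_simp
    ring
  rw [e, div_pos_iff_of_pos_right h, sub_pos]

theorem den_pos_of_le {ρ₁ ρ₂ φ : ℝ} (h0 : 0 ≤ ρ₁) (h12 : ρ₁ ≤ ρ₂) (h1 : ρ₂ < 1)
    (hk : 0 < 1 + ch ρ₂ * Real.cos φ) : 0 < 1 + ch ρ₁ * Real.cos φ := by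
  rw [den_pos_iff (h0.trans h12) h1] at hk
  rw [den_pos_iff h0 (h12.trans_lt h1)]
  have := Real.cos_le_one φ
  have : ρ₁ ^ 2 ≤ ρ₂ ^ 2 := by gcongr
  nlinarith

/-- Written out in ρ², the density has an increasing numerator and a denominator that is a product
of decreasing factors. -/
theorem density_lt_density {ρ₁ ρ₂ φ : ℝ} (h0 : 0 ≤ ρ₁) (h12 : ρ₁ < ρ₂) (h1 : ρ₂ < 1)
    (hk : 0 < 1 + ch ρ₂ * Real.cos φ) :
    sh ρ₁ ^ 3 / (1 + ch ρ₁ * Real.cos φ) ^ 2 < sh ρ₂ ^ 3 / (1 + ch ρ₂ * Real.cos φ) ^ 2 := by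
  have e : ∀ ρ : ℝ, 0 < 1 - ρ ^ 2 → sh ρ ^ 3 / (1 + ch ρ * Real.cos φ) ^ 2 =
      8 * ρ ^ 3 / ((1 - ρ ^ 2) * (1 + Real.cos φ - ρ ^ 2 * (1 - Real.cos φ)) ^ 2) := by
    intro ρ h
    have e' : 1 + ch ρ * Real.cos φ =
        (1 + Real.cos φ - ρ ^ 2 * (1 - Real.cos φ)) / (1 - ρ ^ 2) := by
      unfold ch
      field_simp
      ring
    rw [e', sh]
    field_simp
    ring
  have h2 : 0 ≤ ρ₂ := h0.trans h12.le
  have hsq : ρ₁ ^ 2 < ρ₂ ^ 2 := by gcongr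
  have hlt : 0 < 1 - ρ₂ ^ 2 := by nlinarith
  rw [e _ (by linarith), e _ hlt]
  rw [den_pos_iff h2 h1] at hk
  have hc := Real.cos_le_one φ
  have hm : ρ₁ ^ 2 * (1 - Real.cos φ) ≤ ρ₂ ^ 2 * (1 - Real.cos φ) :=
    mul_le_mul_of_nonneg_right hsq.le (by linarith)
  have hp : 0 < 1 + Real.cos φ - ρ₂ ^ 2 * (1 - Real.cos φ) := by linarith
  have hlt1 : 0 ≤ 1 - ρ₁ ^ 2 := by linarith
  apply div_lt_div₀
  · gcongr
  · gcongr
  · positivity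
  · positivity

/-- The parameters of a standard double bubble. -/
structure Adm (ρ θ : ℝ) : Prop where
  nonneg : 0 ≤ ρ
  lt_one : ρ < 1
  gt : -(Real.pi / 3) < θ
  lt : θ < Real.pi / 3
  upper : 0 < 1 + ch ρ * Real.cos (θ + 2 * Real.pi / 3)
  lower : 0 < 1 + ch ρ * Real.cos (-θ + 2 * Real.pi / 3)

theorem Adm.neg {ρ θ : ℝ} (h : Adm ρ θ) : Adm ρ (-θ) :=
  ⟨h.nonneg, h.lt_one, by linarith [h.lt], by linarith [h.gt], h.lower, by simpa using h.upper⟩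

theorem Adm.mono {ρ₁ ρ₂ θ : ℝ} (h : Adm ρ₂ θ) (h0 : 0 ≤ ρ₁) (h12 : ρ₁ ≤ ρ₂) : Adm ρ₁ θ :=
  ⟨h0, h12.trans_lt h.lt_one, h.gt, h.lt, den_pos_of_le h0 h12 h.lt_one h.upper,
    den_pos_of_le h0 h12 h.lt_one h.lower⟩

/-- The cosine over the whole angular range of the bubble is smallest at one of the two outer caps.
-/
theorem Adm.den_pos {ρ θ φ : ℝ} (h : Adm ρ θ) (h1 : θ - 2 * Real.pi / 3 ≤ φ)
    (h2 : φ ≤ θ + 2 * Real.pi / 3) : 0 < 1 + ch ρ * Real.cos φ := by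
  have hc := ch_ge_one h.nonneg h.lt_one
  have hg := h.gt
  have hl := h.lt
  rcases le_or_gt 0 φ with h3 | h3
  · have := Real.cos_le_cos_of_nonneg_of_le_pi h3 (by linarith) h2
    have h4 := h.upper
    nlinarith
  · have := Real.cos_le_cos_of_nonneg_of_le_pi (by linarith : 0 ≤ -φ)
      (by linarith : -θ + 2 * Real.pi / 3 ≤ Real.pi) (by linarith)
    rw [Real.cos_neg] at this
    have h4 := h.lower
    nlinarith

theorem Adm.of_mem_Icc {ρ θ θ₁ θ₂ : ℝ} (h₁ : Adm ρ θ₁) (h₂ : Adm ρ θ₂) (h : θ ∈ Set.Icc θ₁ θ₂) :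
    Adm ρ θ := by
  have := h₁.gt
  have := h₂.lt
  have := Real.pi_pos
  refine ⟨h₁.nonneg, h₁.lt_one, by linarith [h.1], by linarith [h.2], ?_, ?_⟩
  · exact h₂.den_pos (by linarith [h.1]) (by linarith [h.2])
  · exact h₁.neg.den_pos (by linarith [h.2]) (by linarith [h.1])

/-- The volume, divided by `π`, of the upper region of a standard double bubble. -/
def regionVol (ρ θ : ℝ) : ℝ := capPrim ρ (θ + 2 * Real.pi / 3) - capPrim ρ θ

theorem Adm.regionVol_neg {ρ θ : ℝ} (h : Adm ρ θ) :
    regionVol ρ (-θ) = capPrim ρ θ - capPrim ρ (θ - 2 * Real.pi / 3) := by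
  have hp := Real.pi_pos
  rw [regionVol, capPrim_neg h.nonneg h.lt_one (h.den_pos (by linarith) (by linarith)),
    show -θ + 2 * Real.pi / 3 = -(θ - 2 * Real.pi / 3) by ring,
    capPrim_neg h.nonneg h.lt_one (h.den_pos le_rfl (by linarith))]
  ring

theorem integral_density {ρ a b : ℝ} (h0 : 0 ≤ ρ) (h1 : ρ < 1) (hab : a ≤ b)
    (hk : ∀ φ ∈ Set.Icc a b, 0 < 1 + ch ρ * Real.cos φ) :
    ContinuousOn (fun φ => sh ρ ^ 3 / (1 + ch ρ * Real.cos φ) ^ 2) (Set.Icc a b) ∧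
    ∫ φ in a..b, sh ρ ^ 3 / (1 + ch ρ * Real.cos φ) ^ 2 = capPrim ρ b - capPrim ρ a := by
  have hcont : ContinuousOn (fun φ => sh ρ ^ 3 / (1 + ch ρ * Real.cos φ) ^ 2) (Set.Icc a b) := by
    intro φ hφ
    have : (1 + ch ρ * Real.cos φ) ^ 2 ≠ 0 := by
      have := hk φ hφ
      positivity
    apply ContinuousAt.continuousWithinAt
    fun_prop (disch := assumption)
  refine ⟨hcont, intervalIntegral.integral_eq_sub_of_hasDerivAt (fun φ hφ => ?_) ?_⟩
  · rw [Set.uIcc_of_le hab] at hφ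
    exact hasDerivAt_capPrim h0 h1 (hk φ hφ)
  · apply ContinuousOn.intervalIntegrable
    rwa [Set.uIcc_of_le hab]

theorem regionVol_lt_of_lt_left {ρ₁ ρ₂ θ : ℝ} (h : Adm ρ₂ θ) (h0 : 0 ≤ ρ₁) (h12 : ρ₁ < ρ₂) :
    regionVol ρ₁ θ < regionVol ρ₂ θ := by
  have hp := Real.pi_pos
  have hab : θ < θ + 2 * Real.pi / 3 := by linarith
  obtain ⟨c1, e1⟩ := integral_density h0 (h12.trans h.lt_one) hab.le
    fun φ hφ => (h.mono h0 h12.le).den_pos (by linarith [hφ.1]) hφ.2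
  obtain ⟨c2, e2⟩ := integral_density h.nonneg h.lt_one hab.le
    fun φ hφ => h.den_pos (by linarith [hφ.1]) hφ.2
  rw [regionVol, regionVol, ← e1, ← e2]
  have hlt : ∀ φ ∈ Set.Icc θ (θ + 2 * Real.pi / 3),
      sh ρ₁ ^ 3 / (1 + ch ρ₁ * Real.cos φ) ^ 2 < sh ρ₂ ^ 3 / (1 + ch ρ₂ * Real.cos φ) ^ 2 :=
    fun φ hφ => density_lt_density h0 h12 h.lt_one (h.den_pos (by linarith [hφ.1]) hφ.2)
  exact intervalIntegral.integral_lt_integral_of_continuousOn_of_le_of_exists_lt hab c1 c2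
    (fun φ hφ => (hlt φ ⟨hφ.1.le, hφ.2⟩).le) ⟨θ, ⟨le_rfl, hab.le⟩, hlt θ ⟨le_rfl, hab.le⟩⟩

/-- Turning the bubble adds volume at the outer cap and removes it at the inner cap. The gain
prevails because |θ| < θ + 2π/3 makes the outer denominator the smaller one. -/
theorem regionVol_lt_of_lt_right {ρ θ₁ θ₂ : ℝ} (h0 : 0 < ρ) (h₁ : Adm ρ θ₁) (h₂ : Adm ρ θ₂)
    (h12 : θ₁ < θ₂) : regionVol ρ θ₁ < regionVol ρ θ₂ := by
  have hp := Real.pi_pos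
  have hd : ∀ θ ∈ Set.Icc θ₁ θ₂, HasDerivAt (regionVol ρ)
      (sh ρ ^ 3 / (1 + ch ρ * Real.cos (θ + 2 * Real.pi / 3)) ^ 2 -
        sh ρ ^ 3 / (1 + ch ρ * Real.cos θ) ^ 2) θ := by
    intro θ hθ
    have h := h₁.of_mem_Icc h₂ hθ
    exact ((hasDerivAt_capPrim h.nonneg h.lt_one h.upper).comp_add_const θ _).sub
      (hasDerivAt_capPrim h.nonneg h.lt_one (h.den_pos (by linarith) (by linarith)))
  refine strictMonoOn_of_deriv_pos (convex_Icc θ₁ θ₂)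
    (fun θ hθ => (hd θ hθ).continuousAt.continuousWithinAt) (fun θ hθ => ?_)
    ⟨le_rfl, h12.le⟩ ⟨h12.le, le_rfl⟩ h12
  rw [interior_Icc] at hθ
  have hθ' : θ ∈ Set.Icc θ₁ θ₂ := ⟨hθ.1.le, hθ.2.le⟩
  have h := h₁.of_mem_Icc h₂ hθ'
  rw [(hd θ hθ').deriv, sub_pos]
  have hS := sh_pos h0 h.lt_one
  have hu := h.upper
  have hcos : Real.cos (θ + 2 * Real.pi / 3) < Real.cos θ := by
    rw [← Real.cos_abs θ]
    apply Real.cos_lt_cos_of_nonneg_of_le_pi (abs_nonneg θ)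
    · linarith [h.lt]
    · rcases abs_cases θ with ⟨e, -⟩ | ⟨e, -⟩ <;> rw [e] <;> linarith [h.gt]
  have hC := ch_ge_one h.nonneg h.lt_one
  gcongr

/-- If ρ₁ < ρ₂, equality of the upper volumes forces θ₂ < θ₁, and equality of the lower volumes
forces −θ₂ < −θ₁, a contradiction. -/
theorem bubble_unique {ρ₁ ρ₂ θ₁ θ₂ : ℝ} (hρ₁ : 0 < ρ₁) (hρ₂ : 0 < ρ₂) (h₁ : Adm ρ₁ θ₁)
    (h₂ : Adm ρ₂ θ₂) (hv : regionVol ρ₁ θ₁ = regionVol ρ₂ θ₂)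
    (hw : regionVol ρ₁ (-θ₁) = regionVol ρ₂ (-θ₂)) : ρ₁ = ρ₂ ∧ θ₁ = θ₂ := by
  have key : ∀ {ρ₁ ρ₂ θ₁ θ₂ : ℝ}, 0 < ρ₁ → Adm ρ₁ θ₁ → Adm ρ₂ θ₂ → ρ₁ < ρ₂ →
      regionVol ρ₁ θ₁ = regionVol ρ₂ θ₂ → θ₂ < θ₁ := by
    intro ρ₁ ρ₂ θ₁ θ₂ hρ₁ h₁ h₂ h hv
    have h3 := regionVol_lt_of_lt_left h₂ hρ₁.le h
    have h4 := h₂.mono hρ₁.le h.le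
    rcases lt_trichotomy θ₁ θ₂ with h5 | rfl | h5
    · have := regionVol_lt_of_lt_right hρ₁ h₁ h4 h5
      linarith
    · linarith
    · exact h5
  rcases lt_trichotomy ρ₁ ρ₂ with h | rfl | h
  · have a := key hρ₁ h₁ h₂ h hv
    have b := key hρ₁ h₁.neg h₂.neg h hw
    linarith
  · refine ⟨rfl, ?_⟩
    rcases lt_trichotomy θ₁ θ₂ with h5 | h5 | h5
    · have := regionVol_lt_of_lt_right hρ₁ h₁ h₂ h5
      linarith
    · exact h5
    · have := regionVol_lt_of_lt_right hρ₁ h₂ h₁ h5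
      linarith
  · have a := key hρ₂ h₂ h₁ h hv.symm
    have b := key hρ₂ h₂.neg h₁.neg h hw.symm
    linarith

/-! ### Existence of the bubble. -/

/-- As the cap angle tends to the largest admissible one, the volume tends to infinity. -/
theorem exists_le_regionVol {t : ℝ} (h0 : 0 ≤ t) (h1 : t < Real.pi / 3) (n : ℝ) :
    ∃ ρ, Adm ρ t ∧ 0 < ρ ∧ n ≤ regionVol ρ t := by
  have hp := Real.pi_pos
  set β := t + 2 * Real.pi / 3 with hβ
  have hcos0 : Real.cos β < 0 :=
    Real.cos_neg_of_pi_div_two_lt_of_lt (by linarith) (by linarith)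
  have hcos1 : -1 < Real.cos β := by
    rw [← Real.cos_pi]
    exact Real.cos_lt_cos_of_nonneg_of_le_pi (by linarith) le_rfl (by linarith)
  have hsin : 0 < Real.sin β := Real.sin_pos_of_pos_of_lt_pi (by linarith) (by linarith)
  -- At ρ = m the denominator of the upper cap vanishes: its top reaches the unit sphere. The limit
  -- is taken as ρ increases to m with t fixed.
  set m := √((1 + Real.cos β) / (1 - Real.cos β)) with hm
  have hmpos : 0 < m := Real.sqrt_pos.2 (div_pos (by linarith) (by linarith))
  have hmsq : m ^ 2 = (1 + Real.cos β) / (1 - Real.cos β) :=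
    Real.sq_sqrt (div_pos (by linarith) (by linarith)).le
  have hm1 : m < 1 := by
    have : m ^ 2 < 1 := by
      rw [hmsq, div_lt_one (by linarith)]
      linarith
    nlinarith
  have hne : 1 - m ^ 2 ≠ 0 := by nlinarith
  have hadm : ∀ ρ ∈ Set.Ioo 0 m, Adm ρ t := by
    intro ρ hρ
    have hρ1 : ρ < 1 := hρ.2.trans hm1
    have hk : 0 < 1 + ch ρ * Real.cos β := by
      rw [den_pos_iff hρ.1.le hρ1]
      have : ρ ^ 2 < m ^ 2 := by
        have := hρ.1
        have := hρ.2
        gcongr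
      rwa [hmsq, lt_div_iff₀ (by linarith)] at this
    refine ⟨hρ.1.le, hρ1, by linarith, h1, hk, ?_⟩
    have hc := ch_ge_one hρ.1.le hρ1
    have : Real.cos β ≤ Real.cos (-t + 2 * Real.pi / 3) :=
      Real.cos_le_cos_of_nonneg_of_le_pi (by linarith) (by linarith) (by linarith)
    nlinarith
  have hch : ContinuousAt ch m := ContinuousAt.div (by fun_prop) (by fun_prop) hne
  have hsh : ContinuousAt sh m := ContinuousAt.div (by fun_prop) (by fun_prop) hne
  have hD0 : 1 + ch m * Real.cos β = 0 := by
    rw [ch, hmsq]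
    have h3 : 1 - Real.cos β ≠ 0 := by linarith
    have h4 : Real.cos β ≠ 0 := hcos0.ne
    have h5 : 1 - (1 + Real.cos β) / (1 - Real.cos β) = -2 * Real.cos β / (1 - Real.cos β) := by
      field_simp
      ring
    rw [h5]
    field_simp
    ring
  have hev : ∀ᶠ ρ in nhdsWithin m (Set.Iio m), ρ ∈ Set.Ioo 0 m :=
    Ioo_mem_nhdsLT hmpos
  have hDt : Filter.Tendsto (fun ρ => 1 + ch ρ * Real.cos β) (nhdsWithin m (Set.Iio m))
      (nhds 0) := by
    rw [← hD0]
    exact ((hch.mul_const _).const_add 1).tendsto.mono_left nhdsWithin_le_nhds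
  have hDt' : Filter.Tendsto (fun ρ => 1 + ch ρ * Real.cos β) (nhdsWithin m (Set.Iio m))
      (nhdsWithin 0 (Set.Ioi 0)) :=
    tendsto_nhdsWithin_iff.2 ⟨hDt, hev.mono fun ρ hρ => (hadm ρ hρ).upper⟩
  have hNm : 0 < ch m + Real.cos β + sh m * Real.sin β := by
    have := one_lt_ch hmpos hm1
    have := mul_pos (sh_pos hmpos hm1) hsin
    linarith
  have hNt : Filter.Tendsto (fun ρ => Real.log (ch ρ + Real.cos β + sh ρ * Real.sin β))
      (nhdsWithin m (Set.Iio m)) (nhds (Real.log (ch m + Real.cos β + sh m * Real.sin β))) :=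
    (((hch.add_const _).add (hsh.mul_const _)).log hNm.ne').tendsto.mono_left nhdsWithin_le_nhds
  -- With D the vanishing denominator, D · `capPrim` has a positive limit because D log D tends to
  -- 0; division by D then gives divergence to +∞.
  have hlogD : Filter.Tendsto (fun ρ => (1 + ch ρ * Real.cos β) *
      Real.log (1 + ch ρ * Real.cos β)) (nhdsWithin m (Set.Iio m)) (nhds 0) := by
    have := (Real.continuous_mul_log.tendsto 0).comp hDt
    simpa [Function.comp_def] using this
  have hSC : Filter.Tendsto (fun ρ => sh ρ * ch ρ * Real.sin β) (nhdsWithin m (Set.Iio m))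
      (nhds (sh m * ch m * Real.sin β)) :=
    ((hsh.mul hch).mul_const _).tendsto.mono_left nhdsWithin_le_nhds
  have hlim := (hSC.sub (hDt.mul hNt)).add hlogD
  have hpos : 0 < sh m * ch m * Real.sin β -
      0 * Real.log (ch m + Real.cos β + sh m * Real.sin β) + 0 := by
    have h1 := sh_pos hmpos hm1
    have h2 := one_lt_ch hmpos hm1
    have : 0 < ch m := by linarith
    rw [zero_mul, sub_zero, add_zero]
    positivity
  have htop := (hlim.pos_mul_atTop hpos (tendsto_inv_nhdsGT_zero.comp hDt'))
  have hdent : 0 < 1 + ch m * Real.cos t := by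
    have h2 := one_lt_ch hmpos hm1
    have h3 := Real.cos_pos_of_mem_Ioo (⟨by linarith, by linarith⟩ :
      t ∈ Set.Ioo (-(Real.pi / 2)) (Real.pi / 2))
    positivity
  have ht : Filter.Tendsto (fun ρ => -capPrim ρ t) (nhdsWithin m (Set.Iio m))
      (nhds (-capPrim m t)) := by
    have hc : ContinuousAt (fun ρ => capPrim ρ t) m :=
      (continuousAt_capPrim hmpos.le hm1 hdent).comp (f := fun ρ : ℝ => (ρ, t)) (by fun_prop)
    exact hc.neg.tendsto.mono_left nhdsWithin_le_nhds
  have hall := (htop.atTop_add ht).eventually_ge_atTop n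
  obtain ⟨ρ, hρn, hρ⟩ := (hall.and hev).exists
  refine ⟨ρ, hadm ρ hρ, hρ.1, hρn.trans_eq ?_⟩
  have ha := hadm ρ hρ
  have hk := ha.upper
  have hN := capNum_pos ha.nonneg ha.lt_one hk
  rw [← hβ] at hk hN
  have hcp : capPrim ρ β = sh ρ * ch ρ * Real.sin β / (1 + ch ρ * Real.cos β) -
      (Real.log (ch ρ + Real.cos β + sh ρ * Real.sin β) - Real.log (1 + ch ρ * Real.cos β)) := by
    rw [capPrim, Real.log_div hN.ne' hk.ne']
  rw [regionVol, ← hβ, hcp]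
  simp only [Function.comp]
  field_simp
  ring

theorem continuousAt_regionVol {ρ θ : ℝ} (h : Adm ρ θ) :
    ContinuousAt (fun x : ℝ × ℝ => regionVol x.1 x.2) (ρ, θ) := by
  have hp := Real.pi_pos
  unfold regionVol
  refine ContinuousAt.sub ?_ (continuousAt_capPrim h.nonneg h.lt_one
    (h.den_pos (by linarith) (by linarith)))
  exact ContinuousAt.comp (x := (ρ, θ)) (g := fun x : ℝ × ℝ => capPrim x.1 x.2)
    (f := fun x : ℝ × ℝ => (x.1, x.2 + 2 * Real.pi / 3))
    (continuousAt_capPrim h.nonneg h.lt_one h.upper) (by fun_prop)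

theorem one_add_cos_pos {x : ℝ} (h1 : -Real.pi < x) (h2 : x < Real.pi) : 0 < 1 + Real.cos x := by
  have : Real.cos Real.pi < Real.cos |x| :=
    Real.cos_lt_cos_of_nonneg_of_le_pi (abs_nonneg x) le_rfl (abs_lt.2 ⟨h1, h2⟩)
  rw [Real.cos_pi, Real.cos_abs] at this
  linarith

theorem regionVol_zero {t : ℝ} (h1 : -Real.pi < t) (h2 : t < Real.pi / 3) :
    regionVol 0 t = 0 := by
  have hp := Real.pi_pos
  rw [regionVol, capPrim_zero_left (one_add_cos_pos (by linarith) (by linarith)),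
    capPrim_zero_left (one_add_cos_pos (by linarith) (by linarith)), sub_zero]

/-- Intermediate value theorem in ρ, starting from the degenerate radius 0, where the volume
vanishes; this is why `Adm` allows ρ = 0. -/
theorem exists_regionVol_eq {t n : ℝ} (h0 : 0 ≤ t) (h1 : t < Real.pi / 3) (hn : 0 < n) :
    ∃ ρ, Adm ρ t ∧ 0 < ρ ∧ regionVol ρ t = n := by
  have hp := Real.pi_pos
  obtain ⟨ρ₂, ha, hρ₂, hle⟩ := exists_le_regionVol h0 h1 n
  have hc : ContinuousOn (fun ρ => regionVol ρ t) (Set.Icc 0 ρ₂) := fun ρ hρ =>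
    ((continuousAt_regionVol (ha.mono hρ.1 hρ.2)).comp (f := fun ρ : ℝ => (ρ, t))
      (by fun_prop)).continuousWithinAt
  have hz := regionVol_zero (by linarith : -Real.pi < t) h1
  obtain ⟨ρ, hρ, he⟩ := intermediate_value_Icc hρ₂.le hc ⟨by simpa [hz] using hn.le, hle⟩
  refine ⟨ρ, ha.mono hρ.1 hρ.2, hρ.1.lt_of_ne ?_, he⟩
  rintro rfl
  simp only [hz] at he
  exact hn.ne he

theorem eventually_adm {ρ θ : ℝ} (h : Adm ρ θ) : ∀ᶠ x : ℝ × ℝ in nhds (ρ, θ),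
    0 ≤ x.1 → Adm x.1 x.2 := by
  have hne : 1 - ρ ^ 2 ≠ 0 := by nlinarith [h.nonneg, h.lt_one]
  have hch : ContinuousAt (fun x : ℝ × ℝ => ch x.1) (ρ, θ) := by
    unfold ch
    exact ContinuousAt.div (by fun_prop) (by fun_prop) hne
  have e1 : ∀ᶠ x : ℝ × ℝ in nhds (ρ, θ), x.1 < 1 :=
    continuousAt_fst.eventually_lt continuousAt_const h.lt_one
  have e2 : ∀ᶠ x : ℝ × ℝ in nhds (ρ, θ), -(Real.pi / 3) < x.2 :=
    continuousAt_const.eventually_lt continuousAt_snd h.gt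
  have e3 : ∀ᶠ x : ℝ × ℝ in nhds (ρ, θ), x.2 < Real.pi / 3 :=
    continuousAt_snd.eventually_lt continuousAt_const h.lt
  have e4 : ∀ᶠ x : ℝ × ℝ in nhds (ρ, θ), 0 < 1 + ch x.1 * Real.cos (x.2 + 2 * Real.pi / 3) :=
    continuousAt_const.eventually_lt (by fun_prop) h.upper
  have e5 : ∀ᶠ x : ℝ × ℝ in nhds (ρ, θ), 0 < 1 + ch x.1 * Real.cos (-x.2 + 2 * Real.pi / 3) :=
    continuousAt_const.eventually_lt (by fun_prop) h.lower
  filter_upwards [e1, e2, e3, e4, e5] with x h1 h2 h3 h4 h5 h0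
  exact ⟨h0, h1, h2, h3, h4, h5⟩

/-- There is a standard double bubble with given volumes. -/
theorem bubble_exists {nv nw : ℝ} (hv : 0 < nv) (hvw : nv ≤ nw) :
    ∃ ρ t, 0 < ρ ∧ 0 ≤ t ∧ Adm ρ t ∧ regionVol ρ (-t) = nv ∧ regionVol ρ t = nw := by
  have hp := Real.pi_pos
  have hw : 0 < nw := hv.trans_le hvw
  -- For each t the radius r(t) is fixed by the larger volume. Along this curve the smaller volume
  -- runs from nw at t = 0 to 0 as t tends to π/3, so it takes the value nv. The value 0 outside the
  -- interval is a dummy.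
  have hex : ∀ t : ℝ, ∃ ρ, t ∈ Set.Ico 0 (Real.pi / 3) → Adm ρ t ∧ 0 < ρ ∧ regionVol ρ t = nw := by
    intro t
    by_cases ht : t ∈ Set.Ico 0 (Real.pi / 3)
    · obtain ⟨ρ, h⟩ := exists_regionVol_eq ht.1 ht.2 hw
      exact ⟨ρ, fun _ => h⟩
    · exact ⟨0, fun h => (ht h).elim⟩
  choose r hr using hex
  have hcont : ContinuousOn r (Set.Ico 0 (Real.pi / 3)) := by
    intro t₀ ht₀
    obtain ⟨ha, hpos, he⟩ := hr t₀ ht₀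
    have hmem : ∀ᶠ t in nhdsWithin t₀ (Set.Ico 0 (Real.pi / 3)), t ∈ Set.Ico 0 (Real.pi / 3) :=
      self_mem_nhdsWithin
    have hpair : ∀ u : ℝ, Filter.Tendsto (fun t : ℝ => (u, t)) (nhdsWithin t₀ (Set.Ico 0 (Real.pi / 3)))
        (nhds (u, t₀)) := fun u =>
      (Continuous.tendsto (by fun_prop : Continuous fun t : ℝ => (u, t)) t₀).mono_left
        nhdsWithin_le_nhds
    -- Continuity of r comes from monotonicity in ρ: at a radius below (above) r(t₀) the volume
    -- stays below (above) nw for t near t₀, so r(t) stays on the other side.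
    refine tendsto_order.2 ⟨fun l hl => ?_, fun u hu => ?_⟩
    · rcases le_or_gt l 0 with hl0 | hl0
      · filter_upwards [hmem] with t ht
        exact hl0.trans_lt (hr t ht).2.1
      · have hal := ha.mono hl0.le hl.le
        have hlt : regionVol l t₀ < nw := he ▸ regionVol_lt_of_lt_left ha hl0.le hl
        have e1 := (hpair l).eventually
          ((continuousAt_regionVol hal).eventually_lt continuousAt_const hlt)
        have e2 := (hpair l).eventually (eventually_adm hal)
        filter_upwards [hmem, e1, e2] with t ht h1 h2
        by_contra! hle
        obtain ⟨ha', hpos', he'⟩ := hr t ht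
        rcases hle.eq_or_lt with h3 | h3
        · rw [← h3] at h1
          simp only [he', lt_irrefl] at h1
        · have := regionVol_lt_of_lt_left (h2 hl0.le) hpos'.le h3
          linarith
    · have hpair' : Filter.Tendsto (fun ρ : ℝ => (ρ, t₀)) (nhdsWithin (r t₀) (Set.Ioi (r t₀)))
          (nhds (r t₀, t₀)) :=
        (Continuous.tendsto (by fun_prop : Continuous fun ρ : ℝ => (ρ, t₀)) _).mono_left
          nhdsWithin_le_nhds
      -- The radius u itself need not be admissible, so it is replaced by an admissible u' between
      -- r(t₀) and u.
      obtain ⟨u', hau, hu1, hu2⟩ := ((hpair'.eventually (eventually_adm ha)).and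
        ((Ioo_mem_nhdsGT hu : ∀ᶠ x in _, x ∈ Set.Ioo (r t₀) u))).exists
      have hu0 : 0 < u' := hpos.trans hu1
      have hal := hau hu0.le
      have hlt : nw < regionVol u' t₀ := he ▸ regionVol_lt_of_lt_left hal hpos.le hu1
      have e1 := (hpair u').eventually
        (continuousAt_const.eventually_lt (continuousAt_regionVol hal) hlt)
      filter_upwards [hmem, e1] with t ht h1
      refine lt_of_not_ge fun hle => ?_
      obtain ⟨ha', hpos', he'⟩ := hr t ht
      rcases (hu2.trans_le hle).le.eq_or_lt with h3 | h3
      · rw [h3, he'] at h1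
        exact h1.false
      · have := regionVol_lt_of_lt_left ha' hu0.le h3
        linarith
  have hg : ContinuousOn (fun t => regionVol (r t) (-t)) (Set.Ico 0 (Real.pi / 3)) := by
    intro t ht
    exact ContinuousAt.comp_continuousWithinAt (f := fun t => (r t, -t))
      (continuousAt_regionVol (hr t ht).1.neg) ((hcont t ht).prodMk continuousWithinAt_id.neg)
  have hlim : Filter.Tendsto (fun t => regionVol (r t) (-t))
      (nhdsWithin (Real.pi / 3) (Set.Iio (Real.pi / 3))) (nhds 0) := by
    have hmem : ∀ᶠ t in nhdsWithin (Real.pi / 3) (Set.Iio (Real.pi / 3)),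
        t ∈ Set.Ioo 0 (Real.pi / 3) := Ioo_mem_nhdsLT (by linarith)
    -- Admissibility of the upper cap bounds r(t)² by 1 + cos(t + 2π/3), which vanishes at t = π/3.
    have hrlim : Filter.Tendsto r (nhdsWithin (Real.pi / 3) (Set.Iio (Real.pi / 3))) (nhds 0) := by
      have hup : Filter.Tendsto (fun t => √(1 + Real.cos (t + 2 * Real.pi / 3)))
          (nhdsWithin (Real.pi / 3) (Set.Iio (Real.pi / 3))) (nhds 0) := by
        have hc : Continuous fun t : ℝ => √(1 + Real.cos (t + 2 * Real.pi / 3)) := by fun_prop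
        have := (hc.tendsto (Real.pi / 3)).mono_left
          (nhdsWithin_le_nhds (s := Set.Iio (Real.pi / 3)))
        rw [show Real.pi / 3 + 2 * Real.pi / 3 = Real.pi by ring, Real.cos_pi] at this
        simpa using this
      refine tendsto_of_tendsto_of_tendsto_of_le_of_le' tendsto_const_nhds hup ?_ ?_
      · filter_upwards [hmem] with t ht
        exact (hr t ⟨ht.1.le, ht.2⟩).2.1.le
      · filter_upwards [hmem] with t ht
        obtain ⟨ha, hpos, -⟩ := hr t ⟨ht.1.le, ht.2⟩
        apply Real.le_sqrt_of_sq_le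
        have hu := (den_pos_iff ha.nonneg ha.lt_one _).1 ha.upper
        have hc : Real.cos (t + 2 * Real.pi / 3) < 0 :=
          Real.cos_neg_of_pi_div_two_lt_of_lt (by linarith [ht.1]) (by linarith [ht.2])
        nlinarith [sq_nonneg (r t)]
    have hpt : Filter.Tendsto (fun t => (r t, -t))
        (nhdsWithin (Real.pi / 3) (Set.Iio (Real.pi / 3))) (nhds (0, -(Real.pi / 3))) :=
      hrlim.prodMk_nhds (continuous_neg.continuousWithinAt.tendsto)
    -- The limit point is not admissible, since `Adm` excludes the angle −π/3, so continuity there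
    -- is checked directly.
    have hcz : ContinuousAt (fun x : ℝ × ℝ => regionVol x.1 x.2) (0, -(Real.pi / 3)) := by
      unfold regionVol
      have k1 : 0 < 1 + ch 0 * Real.cos (-(Real.pi / 3) + 2 * Real.pi / 3) := by
        simpa [ch] using one_add_cos_pos
          (by linarith : -Real.pi < -(Real.pi / 3) + 2 * Real.pi / 3) (by linarith)
      have k2 : 0 < 1 + ch 0 * Real.cos (-(Real.pi / 3)) := by
        simpa [ch] using one_add_cos_pos (by linarith : -Real.pi < -(Real.pi / 3)) (by linarith)
      exact ContinuousAt.sub (ContinuousAt.comp (x := ((0 : ℝ), -(Real.pi / 3)))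
        (g := fun x : ℝ × ℝ => capPrim x.1 x.2)
        (f := fun x : ℝ × ℝ => (x.1, x.2 + 2 * Real.pi / 3))
        (continuousAt_capPrim le_rfl one_pos k1) (by fun_prop))
        (continuousAt_capPrim le_rfl one_pos k2)
    have := hcz.tendsto.comp hpt
    simpa [regionVol_zero (by linarith : -Real.pi < -(Real.pi / 3)) (by linarith),
      Function.comp_def] using this
  have hmem : ∀ᶠ t in nhdsWithin (Real.pi / 3) (Set.Iio (Real.pi / 3)),
      t ∈ Set.Ioo 0 (Real.pi / 3) := Ioo_mem_nhdsLT (by linarith)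
  obtain ⟨t₁, hlt, ht₁⟩ := ((hlim.eventually_lt_const hv).and hmem).exists
  have h0 : (0 : ℝ) ∈ Set.Ico 0 (Real.pi / 3) := ⟨le_rfl, by linarith⟩
  obtain ⟨t, ht, he⟩ := intermediate_value_Icc' ht₁.1.le
    (hg.mono fun x hx => ⟨hx.1, hx.2.trans_lt ht₁.2⟩)
    (⟨hlt.le, by simpa [(hr 0 h0).2.2] using hvw⟩ : nv ∈ Set.Icc _ _)
  obtain ⟨ha, hpos, hew⟩ := hr t ⟨ht.1, ht.2.trans_lt ht₁.2⟩
  exact ⟨r t, t, hpos, ht.1, ha, he, hew⟩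

/-! ### Lower bounds for the areas of the spheres. -/

/-- A lower bound for the defect `cosh x - 1 - n`, where `sinh x - x = n`. -/
theorem le_defect {x y n : ℝ} (hy : 1 ≤ y) (hx : Real.sinh x - x = n)
    (h : (y - 1 / y) / 2 - Real.log y ≤ n) :
    Real.log y - 1 + 1 / y ≤ x - 1 + Real.exp (-x) := by
  have hy0 : 0 < y := by linarith
  have hl : Real.log y ≤ x := by
    have hs : Real.sinh (Real.log y) - Real.log y = (y - 1 / y) / 2 - Real.log y := by
      rw [Real.sinh_eq, Real.exp_neg, Real.exp_log hy0, one_div]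
    have : Real.sinh (Real.log y) - Real.log y ≤ Real.sinh x - x := by rw [hs, hx]; exact h
    exact Real.sinh_sub_id_strictMono.le_iff_le.1 this
  -- By exp u ≥ 1 + u, the two sides of the claim differ by at least (x − log y)(1 − 1/y).
  have he : Real.exp (-x) = 1 / y * Real.exp (Real.log y - x) := by
    rw [one_div, ← Real.exp_log (inv_pos.2 hy0), Real.log_inv, ← Real.exp_add]
    congr 1
    ring
  have h1 := Real.add_one_le_exp (Real.log y - x)
  have h2 : 1 / y ≤ 1 := by rw [div_le_one hy0]; exact hy
  have h3 : 0 < 1 / y := by positivity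
  rw [he]
  nlinarith

theorem one_sub_inv_le_log' {x : ℝ} (hx : 0 < x) : (x - 1) / x ≤ Real.log x := by
  have := Real.one_sub_inv_le_log_of_pos hx
  rwa [sub_div, div_self hx.ne', one_div]

/-- The shift m may be negative; `defect_half` uses it so. -/
theorem log_sub_ge {q m : ℝ} (hq : 0 < q) (hm : m < q) :
    Real.log q - m / (q - m) ≤ Real.log (q - m) := by
  have h := one_sub_inv_le_log' (div_pos (sub_pos.2 hm) hq)
  rw [Real.log_div (sub_pos.2 hm).ne' hq.ne'] at h
  have h1 : q - m ≠ 0 := (sub_pos.2 hm).ne'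
  have e : ((q - m) / q - 1) / ((q - m) / q) = -(m / (q - m)) := by
    field_simp
    ring
  rw [e] at h
  linarith

/-- The threshold 86 is the lower bound for q = N/b that follows from N ≥ 2.73 and b ≤ 0.0316. -/
theorem log_86_bounds : 4.4 ≤ Real.log 86 ∧ Real.log 86 ≤ 4.5 := by
  have h1 := Real.exp_one_gt_d9
  have h2 := Real.exp_one_lt_d9
  constructor
  · have h : Real.exp 22 ≤ 86 ^ 5 := by
      rw [show (22 : ℝ) = (22 : ℕ) * 1 by norm_num, Real.exp_nat_mul]
      calc Real.exp 1 ^ 22 ≤ 2.7182818286 ^ 22 := by gcongr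
        _ ≤ _ := by norm_num
    have := (Real.le_log_iff_exp_le (by norm_num)).2 h
    rw [Real.log_pow] at this
    norm_num at this ⊢
    linarith
  · have h : 86 ^ 2 ≤ Real.exp 9 := by
      rw [show (9 : ℝ) = (9 : ℕ) * 1 by norm_num, Real.exp_nat_mul]
      calc (86 : ℝ) ^ 2 ≤ 2.7182818283 ^ 9 := by norm_num
        _ ≤ _ := by gcongr
    have := (Real.log_le_iff_le_exp (by norm_num)).2 h
    rw [Real.log_pow] at this
    norm_num at this ⊢
    linarith

theorem log_bounds_of_86_le {q : ℝ} (hq : 86 ≤ q) :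
    4.4 ≤ Real.log q ∧ Real.log q ≤ q / 86 + 3.5 := by
  obtain ⟨h1, h2⟩ := log_86_bounds
  have h3 : Real.log 86 ≤ Real.log q := Real.log_le_log (by norm_num) hq
  have h4 := Real.log_le_sub_one_of_pos (show 0 < q / 86 by linarith)
  rw [Real.log_div (by linarith) (by norm_num)] at h4
  constructor <;> linarith

theorem exp_two_bounds : 7.389 ≤ Real.exp 2 ∧ Real.exp 2 ≤ 7.38906 := by
  have h1 := Real.exp_one_gt_d9
  have h2 := Real.exp_one_lt_d9
  have e : Real.exp 2 = Real.exp 1 ^ 2 := by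
    rw [← Real.exp_nat_mul]
    norm_num
  rw [e]
  constructor <;> nlinarith

/-- The sphere of half the volume `v`. -/
theorem defect_half {x p q nv : ℝ} (hp : 25 ≤ p) (hpq : p ≤ q) (hnv : p - Real.log p - 3 ≤ nv)
    (hx : Real.sinh x - x = nv / 2) :
    Real.log p - 1 + (Real.log q - 2) / (q + Real.log q - 3) ≤ x - 1 + Real.exp (-x) := by
  have hp0 : 0 < p := by linarith
  have hl3 : 3 ≤ Real.log p := by
    rw [Real.le_log_iff_exp_le hp0]
    have h2 := Real.exp_one_lt_d9
    rw [show (3 : ℝ) = (3 : ℕ) * 1 by norm_num, Real.exp_nat_mul]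
    calc Real.exp 1 ^ 3 ≤ 2.7182818286 ^ 3 := by gcongr
      _ ≤ p := by norm_num at *; linarith
  have hlq : Real.log p ≤ Real.log q := Real.log_le_log hp0 hpq
  set l := Real.log p with hld
  have hy : p ≤ p + l - 3 := by linarith
  have hly : l ≤ Real.log (p + l - 3) := Real.log_le_log hp0 hy
  have h1 : 0 < 1 / (p + l - 3) := by
    have : 0 < p + l - 3 := by linarith
    positivity
  -- The choice of y makes y/2 − log p equal to (p − log p − 3)/2, and log y ≥ log p because l ≥ 3.
  have h := le_defect (y := p + l - 3) (by linarith) hx (by linarith)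
  have hsub := log_sub_ge (q := p) (m := -(l - 3)) hp0 (by linarith)
  rw [show p - -(l - 3) = p + l - 3 by ring, neg_div] at hsub
  have hd : (l - 3) / (p + l - 3) + 1 / (p + l - 3) = (l - 2) / (p + l - 3) := by ring
  -- The gain decreases in the argument, so p may be replaced by the larger q, and all error terms
  -- become functions of q alone.
  have hmono : (Real.log q - 2) / (q + Real.log q - 3) ≤ (l - 2) / (p + l - 3) := by
    rw [div_le_div_iff₀ (by linarith) (by linarith)]
    have h5 : Real.log q - l ≤ (q - p) / p := by
      have := Real.log_le_sub_one_of_pos (show 0 < q / p from div_pos (by linarith) hp0)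
      rw [Real.log_div (by linarith) (by linarith)] at this
      rwa [sub_div, div_self hp0.ne']
    rw [le_div_iff₀ hp0] at h5
    nlinarith [mul_nonneg (sub_nonneg.2 hl3) (sub_nonneg.2 hpq)]
  linarith

/-- The sphere of volume `w`. -/
theorem defect_right {x q nw : ℝ} (hq : 86 ≤ q) (hnw : q - Real.log q - 3.305 ≤ nw)
    (hx : Real.sinh x - x = nw) :
    Real.log 2 + Real.log q - 1 - 2.15 / (q - 2.65) ≤ x - 1 + Real.exp (-x) := by
  have h2 := Real.log_two_gt_d9
  have hlog := log_sub_ge (q := q) (m := 2.65) (by linarith) (by linarith)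
  have hpos : 0 < q - 2.65 := by linarith
  have hy : Real.log (2 * (q - 2.65)) = Real.log 2 + Real.log (q - 2.65) :=
    Real.log_mul two_ne_zero hpos.ne'
  have hs : 2.65 / (q - 2.65) ≤ 0.033 := by
    rw [div_le_iff₀ hpos]
    linarith
  have hi : 0 < 1 / (2 * (q - 2.65)) := by positivity
  -- The shift 2.65 is admissible because 3.305 − 2.65 = 0.655 is below log 2 − 0.033.
  have h := le_defect (y := 2 * (q - 2.65)) (by linarith) hx (by
    rw [hy]
    linarith)
  rw [hy] at h
  have e : 2.65 / (q - 2.65) - 1 / (2 * (q - 2.65)) = 2.15 / (q - 2.65) := by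
    field_simp
    norm_num
  linarith

/-- The sphere of volume `v + w`. -/
theorem defect_sum {x q n : ℝ} (hq : 86 ≤ q)
    (hn : Real.exp 2 / 4 * (q - Real.log q - 3.305) ≤ n) (hx : Real.sinh x - x = n) :
    1 - Real.log 2 + Real.log q - (0.46 * Real.log q + 2.37) / (q - (0.46 * Real.log q + 2.64)) ≤
      x - 1 + Real.exp (-x) := by
  have h2 := Real.log_two_lt_d9
  obtain ⟨e1, e2⟩ := exp_two_bounds
  obtain ⟨l1, l2⟩ := log_bounds_of_86_le hq
  set L := Real.log q with hL
  -- The trial value (e²/2)(q − m) requires (e²/4)(L + 3.305 − m) ≤ log((e²/2)(q − m)). The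
  -- coefficient 0.46 is just above 1 − 4/e², so that the coefficient (e²/4) · 0.54 of L is below 1.
  set m := 0.46 * L + 2.64 with hm
  have hmq : m ≤ 0.0566 * q := by
    rw [hm]
    norm_num at *
    linarith
  have hpos : 0 < q - m := by linarith
  have hlog := log_sub_ge (q := q) (m := m) (by linarith) (by linarith)
  have hs : m / (q - m) ≤ 0.0601 := by
    rw [div_le_iff₀ hpos]
    linarith
  have hy : Real.log (Real.exp 2 / 2 * (q - m)) = 2 - Real.log 2 + Real.log (q - m) := by
    rw [Real.log_mul (by positivity) hpos.ne', Real.log_div (by positivity) two_ne_zero,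
      Real.log_exp]
  have hi : 0 < 1 / (Real.exp 2 / 2 * (q - m)) := by positivity
  have hge : 1 ≤ Real.exp 2 / 2 * (q - m) := by nlinarith
  have h := le_defect (y := Real.exp 2 / 2 * (q - m)) hge hx (by
    rw [hy]
    have : Real.exp 2 / 4 * (L + 3.305 - m) ≤ 2 - Real.log 2 + Real.log (q - m) := by
      have hm' : L + 3.305 - m = 0.54 * L + 0.665 := by rw [hm]; ring
      rw [hm']
      norm_num at *
      nlinarith
    linarith)
  rw [hy] at h
  -- 0.27 is just below 2/e².
  have hi2 : 0.27 / (q - m) ≤ 1 / (Real.exp 2 / 2 * (q - m)) := by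
    rw [div_le_div_iff₀ hpos (by positivity)]
    nlinarith
  have e : m / (q - m) - 0.27 / (q - m) = (0.46 * L + 2.37) / (q - m) := by
    rw [← sub_div, hm]
    norm_num
    ring
  rw [← hL] at hlog
  linarith

/-- Multiplied by q, this is bounded below by an affine function of log q with slope about 1.48,
which is positive from log q = 4.4 on. -/
theorem numerical_gain {q : ℝ} (hq : 86 ≤ q) :
    0 < 2 * ((Real.log q - 2) / (q + Real.log q - 3)) + 3.27 / q - 2.15 / (q - 2.65) -
      (0.46 * Real.log q + 2.37) / (q - (0.46 * Real.log q + 2.64)) := by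
  obtain ⟨l1, l2⟩ := log_bounds_of_86_le hq
  set L := Real.log q
  have hq0 : 0 < q := by linarith
  norm_num at l1 l2
  have h1 : 0.982 * ((L - 2) / q) ≤ (L - 2) / (q + L - 3) := by
    rw [← mul_div_assoc, div_le_div_iff₀ hq0 (by linarith)]
    have : 0.982 * (q + L - 3) ≤ q := by
      norm_num
      linarith
    nlinarith
  have h2 : 2.15 / (q - 2.65) ≤ 2.22 / q := by
    rw [div_le_div_iff₀ (by linarith) hq0]
    linarith
  have h3 : (0.46 * L + 2.37) / (q - (0.46 * L + 2.64)) ≤ 1.06 * ((0.46 * L + 2.37) / q) := by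
    have hmq : 0.46 * L + 2.64 ≤ 0.0566 * q := by
      norm_num
      linarith
    rw [← mul_div_assoc, div_le_div_iff₀ (by linarith) hq0]
    have : q ≤ 1.06 * (q - (0.46 * L + 2.64)) := by linarith
    have : 0 ≤ 0.46 * L + 2.37 := by linarith
    nlinarith
  have h4 : 0 < (2 * 0.982 * (L - 2) + 3.27 - 2.22 - 1.06 * (0.46 * L + 2.37)) / q := by
    apply div_pos _ hq0
    norm_num
    linarith
  have e : (2 * 0.982 * (L - 2) + 3.27 - 2.22 - 1.06 * (0.46 * L + 2.37)) / q =
      2 * (0.982 * ((L - 2) / q)) + 3.27 / q - 2.22 / q - 1.06 * ((0.46 * L + 2.37) / q) := by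
    ring
  linarith

/-! ### Estimates for large double bubbles. -/

/-- The relations between the data of a large standard double bubble: `a` and `b` are the
denominators of the upper and lower cap, `s = sinh r / √3` and `C = cosh r`. -/
structure BubbleData (a b s C : ℝ) : Prop where
  b_pos : 0 < b
  b_le_a : b ≤ a
  s_pos : 0 < s
  s_le_one : s ≤ 1
  s_sq : s ^ 2 = 1 - 4 / 3 * (a + b) + 4 / 9 * (a ^ 2 + a * b + b ^ 2)
  C_sq : C ^ 2 = 3 * s ^ 2 + 1
  C_le : C ≤ 2
  le_C : 2 - (a + b) ≤ C
  b_small : b ≤ 0.0316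
  a_small : a ≤ 0.038

namespace BubbleData

variable {a b s C : ℝ}

/-- The square of 1 − (2/3)(a + b) exceeds s² by exactly (4/9)ab, so s is almost affine in a + b. -/
theorem s_bounds (h : BubbleData a b s C) :
    1 - 0.672 * (a + b) ≤ s ∧ s ≤ 1 - 2 / 3 * (a + b) := by
  obtain ⟨hb, hab, hs, -, hsq, -, -, -, hb1, ha1⟩ := h
  constructor
  · apply le_of_sq_le_sq _ hs.le
    rw [hsq]
    nlinarith [mul_pos hb hb, mul_nonneg hb.le (sub_nonneg.2 hab)]
  · apply le_of_sq_le_sq _ (by linarith)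
    rw [hsq]
    nlinarith [mul_pos hb (hb.trans_le hab)]

/-- Bounds for the numerators in the logarithmic terms. -/
theorem num_bounds (h : BubbleData a b s C) {N x y : ℝ} (hx : 0 < x) (hy : 0 < y)
    (hx1 : x ≤ 0.038) (hy1 : y ≤ 0.038) (hxy : x + y = a + b)
    (hN : C * N = 3 * s ^ 2 + x + s * (3 - x - 2 * y)) :
    2.73 ≤ N ∧ N ≤ 3.15 ∧ N ≤ s * (3 - x - 2 * y) + 1.5 * (a + b) := by
  obtain ⟨s1, s2⟩ := h.s_bounds
  obtain ⟨hb, hab, hs, hs1, hsq, hC, hC2, hCl, hb1, ha1⟩ := h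
  have hCpos : 1.93 ≤ C := by linarith
  have hs3 : 0.953 ≤ s := by linarith
  have hM1 : 2.886 ≤ 3 - x - 2 * y := by linarith
  have hM2 : 3 - x - 2 * y ≤ 3 := by linarith
  have hsM1 : 0.953 * 2.886 ≤ s * (3 - x - 2 * y) := by gcongr
  have hsM2 : s * (3 - x - 2 * y) ≤ 1 * 3 := by gcongr
  have hsqlo : 0.953 ^ 2 ≤ s ^ 2 := by gcongr
  have hsqhi : s ^ 2 ≤ 1 ^ 2 := by gcongr
  have hC0 : 0 < C := by linarith
  have hNpos : 0 < N := by
    have : 0 < C * N := by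
      rw [hN]
      linarith
    exact (mul_pos_iff_of_pos_left hC0).1 this
  refine ⟨?_, ?_, ?_⟩
  · by_contra! hlt
    have : C * N ≤ 2 * 2.73 := by gcongr
    linarith
  · by_contra! hlt
    have : 1.93 * 3.15 ≤ C * N := by gcongr
    linarith
  · by_contra! hlt
    have h1 : (2 - (a + b)) * (s * (3 - x - 2 * y) + 1.5 * (a + b)) < C * N := by
      have h2 : 0 < s * (3 - x - 2 * y) + 1.5 * (a + b) := by linarith
      calc (2 - (a + b)) * (s * (3 - x - 2 * y) + 1.5 * (a + b))
          ≤ C * (s * (3 - x - 2 * y) + 1.5 * (a + b)) := by gcongr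
        _ < C * N := by gcongr
    rw [hN, ← hxy] at h1
    rw [← hxy] at s1 s2
    set u := 1 - 2 / 3 * (x + y) with hu
    -- The expression 3s² − s(3 − x − 2y)(1 − (x + y)) does not decrease when s is replaced by its
    -- upper bound u, which reduces the claim to a polynomial inequality in x and y.
    have h3 : 0 ≤ (u - s) * (3 * (u + s) - (3 - x - 2 * y) * (1 - (x + y))) := by
      apply mul_nonneg (by linarith)
      have : (3 - x - 2 * y) * (1 - (x + y)) ≤ 3 * 1 := by
        gcongr <;> linarith
      linarith
    have h4 : 3 * u ^ 2 + x - u * (3 - x - 2 * y) * (1 - (x + y)) - 3 * (x + y) +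
        1.5 * (x + y) ^ 2 ≤ 0 := by
      rw [hu]
      have h5 : 0 ≤ (x + y) ^ 2 * (5 / 6 - 2 / 3 * (x + y + y)) :=
        mul_nonneg (sq_nonneg _) (by linarith)
      have h6 : 0 ≤ (x + y) * y := by positivity
      linarith
    linarith

/-- The poles cancel: with M = 3 − x − 2y one has 9s² − M² = −3x(2 − x), so 2s(3s − M)/x is bounded
and close to −2. Two outer caps and the inner cap give −2 − 2 + 2; in the first-order terms the
contributions of ±(a − b)/3 cancel. -/
theorem area_term_le (h : BubbleData a b s C) (ha : a ≤ 1.2 * b) :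
    6 * s ^ 2 / a + 6 * s ^ 2 / b + 6 * s ^ 2 / (3 - (a + b)) -
      2 * (s * (3 - a - 2 * b) / a) - 2 * (s * (3 - b - 2 * a) / b) ≤ -2 - 0.6 * (a + b) := by
  obtain ⟨s1, s2⟩ := h.s_bounds
  obtain ⟨hb, hab, hs, hs1, hsq, hC, hC2, hCl, hb1, ha1⟩ := h
  have ha0 : 0 < a := hb.trans_le hab
  have hden : 0 < 3 - (a + b) := by linarith
  have key : ∀ x y : ℝ, 0 < x → 0 < y → x + y = a + b → x ≤ 0.038 → y ≤ 0.038 →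
      s ^ 2 = 1 - 4 / 3 * (x + y) + 4 / 9 * (x ^ 2 + x * y + y ^ 2) →
      6 * s ^ 2 / x - 2 * (s * (3 - x - 2 * y) / x) ≤
        -2 * (1 - 0.345 * (x + y) - (x - y) / 3) := by
    intro x y hx hy hxy hx1 hy1 hsq
    rw [← hxy] at s1 s2
    have hM : 0 < 3 * s + (3 - x - 2 * y) := by linarith
    have e1 : 3 * s - (3 - x - 2 * y) = -3 * x * (2 - x) / (3 * s + (3 - x - 2 * y)) := by
      rw [eq_div_iff hM.ne']
      linear_combination 9 * hsq
    have e : 6 * s ^ 2 / x - 2 * (s * (3 - x - 2 * y) / x) =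
        -2 * (3 * s * (2 - x) / (3 * s + (3 - x - 2 * y))) := by
      rw [show 6 * s ^ 2 / x - 2 * (s * (3 - x - 2 * y) / x) =
        2 * s * (3 * s - (3 - x - 2 * y)) / x by ring, e1]
      field_simp
    rw [e]
    have : 1 - 0.345 * (x + y) - (x - y) / 3 ≤ 3 * s * (2 - x) / (3 * s + (3 - x - 2 * y)) := by
      rw [le_div_iff₀ hM]
      have h1 : 0 ≤ (s - (1 - 0.672 * (x + y))) * (1 - x + 0.345 * (x + y) + (x - y) / 3) :=
        mul_nonneg (by linarith) (by linarith)
      nlinarith [mul_nonneg hx.le (sub_nonneg.2 hx1), mul_nonneg hx.le (sub_nonneg.2 hy1),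
        mul_nonneg hy.le (sub_nonneg.2 hx1), mul_nonneg hy.le (sub_nonneg.2 hy1), mul_pos hx hy]
    linarith
  have h1 := key a b ha0 hb rfl ha1 (by linarith) hsq
  have h2 := key b a hb ha0 (add_comm _ _) (by linarith) ha1
    (by rw [hsq]; ring)
  have h3 : 6 * s ^ 2 / (3 - (a + b)) ≤ 2 - 1.98 * (a + b) := by
    rw [div_le_iff₀ hden]
    have : s ^ 2 ≤ (1 - 2 / 3 * (a + b)) ^ 2 := by gcongr
    nlinarith [mul_nonneg (by linarith : 0 ≤ a + b) (by linarith : 0 ≤ 0.07 - (a + b))]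
  linarith

end BubbleData

namespace BubbleData

variable {a b s C : ℝ}

theorem of_volumes {η nv nw lp lq : ℝ} (hb : 0 < b) (hab : b ≤ a) (hσ : a + b ≤ 3 / 2) (hs : 0 < s)
    (hsq : s ^ 2 = 1 - 4 / 3 * (a + b) + 4 / 9 * (a ^ 2 + a * b + b ^ 2))
    (hC : C ^ 2 = 3 * s ^ 2 + 1) (hC2 : C ≤ 2) (hCl : 2 - (a + b) ≤ C)
    (hη0 : 0 ≤ η) (hη : η ≤ s * (a - b) / (3 - (a + b)))
    (hlp : 0 ≤ lp) (hlq : 0 ≤ lq) (hnv : nv = s * (3 - a - 2 * b) / a - lp + η)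
    (hnw : nw = s * (3 - b - 2 * a) / b - lq - η) (hw : 95 ≤ nw) (hv : 0.847 * nw ≤ nv) :
    BubbleData a b s C := by
  have ha : 0 < a := hb.trans_le hab
  have hs1 : s ≤ 1 := by nlinarith
  refine ⟨hb, hab, hs, hs1, hsq, hC, hC2, hCl, ?_, ?_⟩
  · have h1 : 95 ≤ s * (3 - b - 2 * a) / b := by linarith
    rw [le_div_iff₀ hb] at h1
    nlinarith
  · have h2 : s * (a - b) / (3 - (a + b)) ≤ 4 / 3 := by
      rw [div_le_iff₀ (by linarith)]
      nlinarith
    have h1 : 79.13 ≤ s * (3 - a - 2 * b) / a := by linarith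
    rw [le_div_iff₀ ha] at h1
    nlinarith

theorem lens_le (h : BubbleData a b s C) : s * (a - b) / (3 - (a + b)) ≤ (a - b) / 2.9 := by
  have := h.b_small
  have := h.a_small
  have := h.b_le_a
  have := h.s_le_one
  have := h.s_pos
  rw [div_le_div_iff₀ (by linarith) (by norm_num)]
  nlinarith

/-- Since 0.847 · 1.2 > 1, a larger ratio makes the main term X of nv at most 0.847Y, with Y that of
nw. As log z ≤ z − 1, the deficit 0.847Y − X outweighs the difference of logarithms. What remains is
0.153 log Y > 0.67 against errors that total less than 0.45. -/
theorem ratio_le (h : BubbleData a b s C) {η nv nw p q : ℝ}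
    (hη : η ≤ s * (a - b) / (3 - (a + b)))
    (hp : C * (p * a) = 3 * s ^ 2 + a + s * (3 - a - 2 * b))
    (hq : C * (q * b) = 3 * s ^ 2 + b + s * (3 - b - 2 * a))
    (hnv : nv = s * (3 - a - 2 * b) / a - Real.log p + η)
    (hnw : nw = s * (3 - b - 2 * a) / b - Real.log q - η) (hv : 0.847 * nw ≤ nv) :
    a ≤ 1.2 * b := by
  by_contra! hlt
  obtain ⟨s1, s2⟩ := h.s_bounds
  have hb := h.b_pos
  have hab := h.b_le_a
  have ha1 := h.a_small
  have hb1 := h.b_small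
  have ha : 0 < a := hb.trans_le hab
  obtain ⟨hp1, hp2, -⟩ := h.num_bounds ha hb ha1 (by linarith) rfl hp
  obtain ⟨hq1, hq2, -⟩ := h.num_bounds hb ha (by linarith) ha1 (add_comm _ _) hq
  have hl := hη.trans h.lens_le
  have hMa : 0.953 * 2.886 ≤ s * (3 - a - 2 * b) := by
    gcongr <;> linarith
  have hMb : 0.953 * 2.886 ≤ s * (3 - b - 2 * a) := by
    gcongr <;> linarith
  have hMa2 : s * (3 - a - 2 * b) ≤ 1 * 3 := by
    have := h.s_le_one
    gcongr
    · linarith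
    · linarith
  have hXY : s * (3 - a - 2 * b) / a ≤ 0.847 * (s * (3 - b - 2 * a) / b) := by
    rw [← mul_div_assoc, div_le_div_iff₀ ha hb]
    have h1 : (3 - a - 2 * b) * b ≤ 0.847 * (3 - b - 2 * a) * a := by
      have h2 : 0.847 * (3 - b - 2 * a) * (1.2 * b) ≤ 0.847 * (3 - b - 2 * a) * a := by
        gcongr
        linarith
      nlinarith
    have := mul_le_mul_of_nonneg_left h1 h.s_pos.le
    linarith
  set X := s * (3 - a - 2 * b) / a with hX
  set Y := s * (3 - b - 2 * a) / b with hY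
  have hX1 : 1 ≤ X := by
    rw [hX, le_div_iff₀ ha]
    linarith
  have hY86 : 86 ≤ Y := by
    rw [hY, le_div_iff₀ hb]
    linarith
  have hlY := (log_bounds_of_86_le hY86).1
  have hpX : 0.9 * X ≤ p := by
    refine le_of_mul_le_mul_right ?_ ha
    rw [hX, mul_assoc, div_mul_cancel₀ _ ha.ne']
    linarith
  have hqY : q ≤ 1.15 * Y := by
    refine le_of_mul_le_mul_right ?_ hb
    rw [hY, mul_assoc, div_mul_cancel₀ _ hb.ne']
    linarith
  have hlp : Real.log X - 0.112 ≤ Real.log p := by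
    have h1 := Real.log_le_log (by linarith) hpX
    rw [Real.log_mul (by norm_num) (by linarith)] at h1
    have h2 := one_sub_inv_le_log' (x := 0.9) (by norm_num)
    norm_num at h1 h2 ⊢
    linarith
  have hlq : Real.log q ≤ Real.log Y + 0.15 := by
    have hq0 : 0 < q := pos_of_mul_pos_left (by linarith : 0 < q * b) hb.le
    have h1 := Real.log_le_log hq0 hqY
    rw [Real.log_mul (by norm_num) (by linarith)] at h1
    have h2 := Real.log_le_sub_one_of_pos (x := 1.15) (by norm_num)
    norm_num at h1 h2 ⊢
    linarith
  have hmono : Real.log Y - 0.182 - Real.log X ≤ 0.847 * Y - X := by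
    have h1 := Real.log_le_sub_one_of_pos (x := 0.847 * Y / X)
      (div_pos (by linarith) (by linarith))
    rw [Real.log_div (by linarith) (by linarith), Real.log_mul (by norm_num) (by linarith)] at h1
    have h2 := one_sub_inv_le_log' (x := 0.847) (by norm_num)
    have h3 : 0.847 * Y / X - 1 ≤ 0.847 * Y - X := by
      rw [div_sub_one (by linarith), div_le_iff₀ (by linarith)]
      nlinarith
    norm_num at h1 h2 h3 ⊢
    linarith
  have : (a - b) / 2.9 ≤ 0.0132 := by
    rw [div_le_iff₀ (by norm_num)]
    linarith
  linarith

/-- The final inequality: the Hutchings function is positive. -/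
theorem hutchings_pos (h : BubbleData a b s C) {η nv nw p q x₁ x₂ x₃ : ℝ} (hη0 : 0 ≤ η)
    (hη : η ≤ s * (a - b) / (3 - (a + b)))
    (hp : C * (p * a) = 3 * s ^ 2 + a + s * (3 - a - 2 * b))
    (hq : C * (q * b) = 3 * s ^ 2 + b + s * (3 - b - 2 * a))
    (hnv : nv = s * (3 - a - 2 * b) / a - Real.log p + η)
    (hnw : nw = s * (3 - b - 2 * a) / b - Real.log q - η) (hw : 0 ≤ nw)
    (hv : (Real.exp 2 / 4 - 1) * nw ≤ nv)
    (h₁ : Real.sinh x₁ - x₁ = nv / 2) (h₂ : Real.sinh x₂ - x₂ = nw)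
    (h₃ : Real.sinh x₃ - x₃ = nv + nw) :
    0 < 4 * (Real.cosh x₁ - 1) + 2 * (Real.cosh x₂ - 1) + 2 * (Real.cosh x₃ - 1) -
      4 * (3 * s ^ 2 / a + 3 * s ^ 2 / b + 3 * s ^ 2 / (3 - (a + b))) := by
  have he := exp_two_bounds.1
  have hv' : 0.847 * nw ≤ nv := by nlinarith
  have hratio := h.ratio_le hη hp hq hnv hnw hv'
  have hb := h.b_pos
  have hab := h.b_le_a
  have ha1 := h.a_small
  have hb1 := h.b_small
  have ha : 0 < a := hb.trans_le hab
  obtain ⟨hp1, hp2, hp3⟩ := h.num_bounds ha hb ha1 (by linarith) rfl hp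
  obtain ⟨hq1, hq2, hq3⟩ := h.num_bounds hb ha (by linarith) ha1 (add_comm _ _) hq
  have hl := hη.trans h.lens_le
  have hl2 : (a - b) / 2.9 ≤ 0.005 := by
    rw [div_le_iff₀ (by norm_num)]
    linarith
  have hp25 : 25 ≤ p := by
    refine le_of_mul_le_mul_right ?_ ha
    linarith
  have hq86 : 86 ≤ q := by
    refine le_of_mul_le_mul_right ?_ hb
    linarith
  have hpq : p ≤ q := by
    have hC : 0 < C * (a * b) := by
      have := h.le_C
      have : 0 < C := by linarith
      positivity
    refine le_of_mul_le_mul_left ?_ hC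
    have h1 : 0 ≤ (a - b) * (3 * s ^ 2 + s * (3 - 2 * (a + b))) := by
      have := h.s_pos
      have : 0 ≤ 3 - 2 * (a + b) := by linarith
      have : 0 ≤ a - b := by linarith
      positivity
    linear_combination h1 + b * hp - a * hq
  -- The numerators exceed the main terms by at most 1.5(a + b), which is at most 3a and, by a ≤
  -- 1.2b, at most 3.3b. Together with η ≤ 0.005 the latter gives the constant 3.305.
  have hk1 : p - 3 ≤ s * (3 - a - 2 * b) / a := by
    rw [le_div_iff₀ ha]
    linarith
  have hk2 : q - 3.3 ≤ s * (3 - b - 2 * a) / b := by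
    rw [le_div_iff₀ hb]
    linarith
  have g1 := defect_half hp25 hpq (by linarith) h₁
  have g2 := defect_right hq86 (by linarith) h₂
  have g3 := defect_sum hq86 (by
    have : q - Real.log q - 3.305 ≤ nw := by linarith
    calc Real.exp 2 / 4 * (q - Real.log q - 3.305) ≤ Real.exp 2 / 4 * nw := by gcongr
      _ ≤ nv + nw := by linarith) h₃
  have gain := numerical_gain hq86
  have harea := h.area_term_le hratio
  -- q(a + b) ≥ 2qb ≥ 2 · 2.73, and 0.6 · 5.46 > 3.27.
  have hσ : 3.27 / q ≤ 0.6 * (a + b) := by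
    rw [div_le_iff₀ (by linarith)]
    have : q * b ≤ q * a := by gcongr
    linarith
  have hcosh : ∀ x, Real.cosh x = Real.sinh x + Real.exp (-x) := fun x => by
    rw [Real.cosh_eq, Real.sinh_eq]
    ring
  have e1 : Real.cosh x₁ - 1 = nv / 2 + (x₁ - 1 + Real.exp (-x₁)) := by
    rw [hcosh]
    linarith
  have e2 : Real.cosh x₂ - 1 = nw + (x₂ - 1 + Real.exp (-x₂)) := by
    rw [hcosh]
    linarith
  have e3 : Real.cosh x₃ - 1 = nv + nw + (x₃ - 1 + Real.exp (-x₃)) := by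
    rw [hcosh]
    linarith
  have e4 : 6 * s ^ 2 / a + 6 * s ^ 2 / b + 6 * s ^ 2 / (3 - (a + b)) =
      2 * (3 * s ^ 2 / a + 3 * s ^ 2 / b + 3 * s ^ 2 / (3 - (a + b))) := by ring
  rw [e1, e2, e3]
  linarith

end BubbleData

/-! ### From the geometric parameters to the estimates. -/

theorem log_capNum_div_nonneg {ρ φ : ℝ} (h0 : 0 ≤ ρ) (h1 : ρ < 1)
    (hk : 0 < 1 + ch ρ * Real.cos φ) (hs : 0 ≤ Real.sin φ) :
    0 ≤ Real.log ((ch ρ + Real.cos φ + sh ρ * Real.sin φ) / (1 + ch ρ * Real.cos φ)) := by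
  apply Real.log_nonneg
  rw [le_div_iff₀ hk]
  have := mul_nonneg (sub_nonneg.2 (ch_ge_one h0 h1)) (sub_nonneg.2 (Real.cos_le_one φ))
  have := mul_nonneg (sh_nonneg h0 h1) hs
  linarith

theorem capPrim_nonneg {ρ t : ℝ} (h0 : 0 ≤ ρ) (h1 : ρ < 1) (ht : 0 ≤ t)
    (hk : ∀ φ ∈ Set.Icc 0 t, 0 < 1 + ch ρ * Real.cos φ) : 0 ≤ capPrim ρ t := by
  have e := (integral_density h0 h1 ht hk).2
  have hz : capPrim ρ 0 = 0 := by
    have : ch ρ + 1 ≠ 0 := by linarith [ch_ge_one h0 h1]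
    simp [capPrim, add_comm 1 (ch ρ), this]
  rw [hz, sub_zero] at e
  rw [← e]
  apply intervalIntegral.integral_nonneg ht
  intro φ hφ
  have := hk φ hφ
  have := sh_nonneg h0 h1
  positivity

theorem cos_two_pi_div_three : Real.cos (2 * Real.pi / 3) = -(1 / 2) := by
  rw [show 2 * Real.pi / 3 = Real.pi - Real.pi / 3 by ring, Real.cos_pi_sub, Real.cos_pi_div_three]

theorem sin_two_pi_div_three : Real.sin (2 * Real.pi / 3) = √3 / 2 := by
  rw [show 2 * Real.pi / 3 = Real.pi - Real.pi / 3 by ring, Real.sin_pi_sub, Real.sin_pi_div_three]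

/-- The Hutchings function, divided by `π`, is positive. -/
theorem hutchings_pos_of_adm {ρ t nv nw x₁ x₂ x₃ : ℝ} (hρ : 0 < ρ) (ht : 0 ≤ t) (h : Adm ρ t)
    (hnv : regionVol ρ (-t) = nv) (hnw : regionVol ρ t = nw) (hw : 95 ≤ nw)
    (hv : (Real.exp 2 / 4 - 1) * nw ≤ nv) (h₁ : Real.sinh x₁ - x₁ = nv / 2)
    (h₂ : Real.sinh x₂ - x₂ = nw) (h₃ : Real.sinh x₃ - x₃ = nv + nw) :
    0 < 4 * (Real.cosh x₁ - 1) + 2 * (Real.cosh x₂ - 1) + 2 * (Real.cosh x₃ - 1) -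
      4 * (sh ρ ^ 2 / (1 + ch ρ * Real.cos (-t + 2 * Real.pi / 3)) +
        sh ρ ^ 2 / (1 + ch ρ * Real.cos (t + 2 * Real.pi / 3)) +
        sh ρ ^ 2 / (1 + ch ρ * Real.cos t)) := by
  have hp := Real.pi_pos
  have hlt := h.lt
  have hα := h.lower
  have hβ := h.upper
  have hkt : 0 < 1 + ch ρ * Real.cos t := h.den_pos (by linarith) (by linarith)
  have hsα : 0 ≤ Real.sin (-t + 2 * Real.pi / 3) :=
    Real.sin_nonneg_of_nonneg_of_le_pi (by linarith) (by linarith)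
  have hsβ : 0 ≤ Real.sin (t + 2 * Real.pi / 3) :=
    Real.sin_nonneg_of_nonneg_of_le_pi (by linarith) (by linarith)
  have hst : 0 ≤ Real.sin t := Real.sin_nonneg_of_nonneg_of_le_pi ht (by linarith)
  have hct : 1 / 2 ≤ Real.cos t := by
    rw [← Real.cos_pi_div_three]
    exact Real.cos_le_cos_of_nonneg_of_le_pi ht (by linarith) hlt.le
  have hlα := log_capNum_div_nonneg h.nonneg h.lt_one hα hsα
  have hlβ := log_capNum_div_nonneg h.nonneg h.lt_one hβ hsβ
  have hlt' := log_capNum_div_nonneg h.nonneg h.lt_one hkt hst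
  have hη0 : 0 ≤ capPrim ρ t := capPrim_nonneg h.nonneg h.lt_one ht fun φ hφ =>
    h.den_pos (by linarith [hφ.1]) (by linarith [hφ.2])
  have hneg := capPrim_neg h.nonneg h.lt_one hkt
  have hC1 := one_lt_ch hρ h.lt_one
  have hS := sh_pos hρ h.lt_one
  have hSq := sh_sq hρ h.lt_one
  have hsc := Real.sin_sq_add_cos_sq t
  have h3 : √3 ^ 2 = (3 : ℝ) := Real.sq_sqrt (by norm_num)
  have h3p : 0 < √(3 : ℝ) := by positivity
  have ecα : Real.cos (-t + 2 * Real.pi / 3) = -(Real.cos t) / 2 + √3 / 2 * Real.sin t := by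
    rw [Real.cos_add, cos_two_pi_div_three, sin_two_pi_div_three, Real.cos_neg, Real.sin_neg]
    ring
  have ecβ : Real.cos (t + 2 * Real.pi / 3) = -(Real.cos t) / 2 - √3 / 2 * Real.sin t := by
    rw [Real.cos_add, cos_two_pi_div_three, sin_two_pi_div_three]
    ring
  have esα : Real.sin (-t + 2 * Real.pi / 3) = Real.sin t / 2 + √3 / 2 * Real.cos t := by
    rw [Real.sin_add, cos_two_pi_div_three, sin_two_pi_div_three, Real.cos_neg, Real.sin_neg]
    ring
  have esβ : Real.sin (t + 2 * Real.pi / 3) = -Real.sin t / 2 + √3 / 2 * Real.cos t := by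
    rw [Real.sin_add, cos_two_pi_div_three, sin_two_pi_div_three]
    ring
  have hvf : nv = capPrim ρ (-t + 2 * Real.pi / 3) + capPrim ρ t := by
    rw [← hnv, regionVol, hneg]
    ring
  have hwf : nw = capPrim ρ (t + 2 * Real.pi / 3) - capPrim ρ t := by
    rw [← hnw, regionVol]
  have hηle : capPrim ρ t ≤ sh ρ * ch ρ * Real.sin t / (1 + ch ρ * Real.cos t) := by
    unfold capPrim
    linarith
  unfold capPrim at hvf hwf
  rw [show sh ρ * ch ρ * Real.sin t / (1 + ch ρ * Real.cos t) -
    Real.log ((ch ρ + Real.cos t + sh ρ * Real.sin t) / (1 + ch ρ * Real.cos t)) = capPrim ρ t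
    from rfl] at hvf hwf
  set η := capPrim ρ t
  set a := 1 + ch ρ * Real.cos (-t + 2 * Real.pi / 3) with ha
  set b := 1 + ch ρ * Real.cos (t + 2 * Real.pi / 3) with hb
  set Nα := ch ρ + Real.cos (-t + 2 * Real.pi / 3) + sh ρ * Real.sin (-t + 2 * Real.pi / 3) with hNα
  set Nβ := ch ρ + Real.cos (t + 2 * Real.pi / 3) + sh ρ * Real.sin (t + 2 * Real.pi / 3) with hNβ
  -- This scaling removes √3 from the trigonometry of angles differing by 2π/3: the products `sh` ·
  -- `ch` · sin become polynomials in s, a, b, and s tends to 1 for large bubbles.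
  set s := sh ρ / √3 with hs
  clear_value η a b Nα Nβ s
  have hSs : sh ρ = s * √3 := by
    rw [hs]
    field_simp
  have hs0 : 0 < s := hs ▸ div_pos hS h3p
  have hs2 : 3 * s ^ 2 = sh ρ ^ 2 := by
    rw [hSs, mul_pow, h3]
    ring
  have hsum : 1 + ch ρ * Real.cos t = 3 - (a + b) := by
    rw [ha, hb, ecα, ecβ]
    ring
  have eα : sh ρ * ch ρ * Real.sin (-t + 2 * Real.pi / 3) = s * (3 - a - 2 * b) := by
    rw [esα, ha, hb, ecα, ecβ, hSs]
    linear_combination (s * ch ρ * Real.cos t / 2) * h3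
  have eβ : sh ρ * ch ρ * Real.sin (t + 2 * Real.pi / 3) = s * (3 - b - 2 * a) := by
    rw [esβ, ha, hb, ecα, ecβ, hSs]
    linear_combination (s * ch ρ * Real.cos t / 2) * h3
  have et : sh ρ * ch ρ * Real.sin t = s * (a - b) := by
    rw [ha, hb, ecα, ecβ, hSs]
    ring
  rw [eα] at hvf
  rw [eβ] at hwf
  rw [et, hsum] at hηle
  have hssq : s ^ 2 = 1 - 4 / 3 * (a + b) + 4 / 9 * (a ^ 2 + a * b + b ^ 2) := by
    have e : s ^ 2 = (ch ρ ^ 2 - 1) / 3 := by linarith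
    rw [e, ha, hb, ecα, ecβ]
    linear_combination (-ch ρ ^ 2 / 3) * hsc - (ch ρ ^ 2 * Real.sin t ^ 2 / 9) * h3
  have hab : b ≤ a := by
    rw [ha, hb, ecα, ecβ]
    have : 0 ≤ ch ρ * (√3 * Real.sin t) := by positivity
    linarith
  have hC2 : ch ρ ≤ 2 := by
    have h5 : Real.cos (t + 2 * Real.pi / 3) ≤ -(1 / 2) := by
      rw [← cos_two_pi_div_three]
      exact Real.cos_le_cos_of_nonneg_of_le_pi (by linarith) (by linarith) (by linarith)
    have := mul_le_mul_of_nonneg_left h5 (by linarith : 0 ≤ ch ρ)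
    linarith
  have hx : ch ρ * Real.cos t = 2 - (a + b) := by linarith
  have hle : 2 - (a + b) ≤ ch ρ := by
    rw [← hx]
    exact mul_le_of_le_one_right (by linarith) (Real.cos_le_one t)
  have hσ : a + b ≤ 3 / 2 := by
    have := mul_le_mul hC1.le hct (by norm_num) (by linarith)
    linarith
  have hv' : 0.847 * nw ≤ nv :=
    (mul_le_mul_of_nonneg_right (by linarith [exp_two_bounds.1]) (by linarith)).trans hv
  have hdata : BubbleData a b s (ch ρ) := BubbleData.of_volumes hβ hab hσ hs0 hssq (by linarith)
    hC2 hle hη0 hηle hlα hlβ hvf hwf hw hv'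
  have hp' : ch ρ * (Nα / a * a) = 3 * s ^ 2 + a + s * (3 - a - 2 * b) := by
    rw [div_mul_cancel₀ _ hα.ne', hs2, hSq, ← eα, hNα, ha]
    ring
  have hq' : ch ρ * (Nβ / b * b) = 3 * s ^ 2 + b + s * (3 - b - 2 * a) := by
    rw [div_mul_cancel₀ _ hβ.ne', hs2, hSq, ← eβ, hNβ, hb]
    ring
  have := hdata.hutchings_pos hη0 hηle hp' hq' hvf hwf (by linarith) hv h₁ h₂ h₃
  rw [hs2] at this
  rwa [hsum]

/-! ### Round spheres: volume, area, existence and uniqueness. -/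

/-- The hyperbolic diameter of the ball of Euclidean radius `R` about the origin. -/
def diam (R : ℝ) : ℝ := 2 * Real.log ((1 + R) / (1 - R))

theorem exp_diam {R : ℝ} (h0 : 0 < R) (h1 : R < 1) :
    Real.exp (diam R) = ((1 + R) / (1 - R)) ^ 2 := by
  have h : 0 < (1 + R) / (1 - R) := div_pos (by linarith) (by linarith)
  rw [diam, mul_comm, Real.exp_mul, Real.exp_log h]
  norm_num

theorem diam_pos {R : ℝ} (h0 : 0 < R) (h1 : R < 1) : 0 < diam R := by
  have : 1 < (1 + R) / (1 - R) := by
    rw [lt_div_iff₀ (by linarith)]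
    linarith
  exact mul_pos two_pos (Real.log_pos this)

theorem sinh_diam {R : ℝ} (h0 : 0 < R) (h1 : R < 1) :
    Real.sinh (diam R) = 2 * sh R * ch R := by
  have h2 : 1 - R ≠ 0 := by linarith
  have h3 : 1 + R ≠ 0 := by linarith
  have h4 : 1 - R ^ 2 ≠ 0 := (one_sub_sq_pos h0 h1).ne'
  rw [Real.sinh_eq, Real.exp_neg, exp_diam h0 h1, sh, ch,
    show 1 - R ^ 2 = (1 - R) * (1 + R) by ring]
  field_simp
  ring

theorem cosh_diam {R : ℝ} (h0 : 0 < R) (h1 : R < 1) :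
    Real.cosh (diam R) = 1 + 2 * sh R ^ 2 := by
  have h2 : 1 - R ≠ 0 := by linarith
  have h3 : 1 + R ≠ 0 := by linarith
  rw [Real.cosh_eq, Real.exp_neg, exp_diam h0 h1, sh,
    show 1 - R ^ 2 = (1 - R) * (1 + R) by ring]
  field_simp
  ring

theorem diam_injOn : Set.InjOn diam (Set.Ioo 0 1) := by
  intro R hR T hT h
  have e := congrArg Real.exp h
  rw [exp_diam hR.1 hR.2, exp_diam hT.1 hT.2] at e
  have h1 : 0 < 1 - R := by linarith [hR.2]
  have h2 : 0 < 1 - T := by linarith [hT.2]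
  have h3 : 0 < 1 + R := by linarith [hR.1]
  have h4 : 0 < 1 + T := by linarith [hT.1]
  rw [sq_eq_sq₀ (by positivity) (by positivity), div_eq_div_iff h1.ne' h2.ne'] at e
  linarith

theorem exists_diam_eq {x : ℝ} (hx : 0 < x) : ∃ R ∈ Set.Ioo (0 : ℝ) 1, diam R = x := by
  have h1 : 1 < Real.exp (x / 2) := Real.one_lt_exp_iff.2 (by linarith)
  -- The witness is tanh(x/4).
  refine ⟨(Real.exp (x / 2) - 1) / (Real.exp (x / 2) + 1),
    ⟨div_pos (by linarith) (by linarith), ?_⟩, ?_⟩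
  · rw [div_lt_one (by linarith)]
    linarith
  · have e : (1 + (Real.exp (x / 2) - 1) / (Real.exp (x / 2) + 1)) /
        (1 - (Real.exp (x / 2) - 1) / (Real.exp (x / 2) + 1)) = Real.exp (x / 2) := by
      have : Real.exp (x / 2) + 1 ≠ 0 := by linarith
      rw [show 1 - (Real.exp (x / 2) - 1) / (Real.exp (x / 2) + 1) = 2 / (Real.exp (x / 2) + 1) by
        field_simp
        ring]
      field_simp
      ring
    rw [diam, e, Real.log_exp]
    ring

theorem exists_sinh_sub_self_eq {n : ℝ} (hn : 0 < n) : ∃ x, 0 < x ∧ Real.sinh x - x = n := by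
  have hb : n ≤ Real.sinh (4 * (n + 1)) - 4 * (n + 1) := by
    have h1 := Real.quadratic_le_exp_of_nonneg (by linarith : 0 ≤ 4 * (n + 1))
    have h2 : Real.exp (-(4 * (n + 1))) ≤ 1 := Real.exp_le_one_iff.2 (by linarith)
    rw [Real.sinh_eq]
    nlinarith
  obtain ⟨x, hx, he⟩ := intermediate_value_Icc (f := fun x => Real.sinh x - x)
    (by linarith : 0 ≤ 4 * (n + 1)) (by fun_prop) ⟨by simpa using hn.le, hb⟩
  refine ⟨x, hx.1.lt_of_ne ?_, he⟩
  rintro rfl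
  simp only [Real.sinh_zero, sub_zero] at he
  exact hn.ne he

/-- Up to a null set the ball is the region between the two hemispheres, at the angles ±π/2, so its
volume is 2π · `capPrim` R (π/2). -/
theorem hypVol_ball {R : ℝ} (h0 : 0 < R) (h1 : R < 1) :
    hypVol (Metric.ball 0 R) = ENNReal.ofReal (Real.pi * (Real.sinh (diam R) - diam R)) := by
  have hp := Real.pi_pos
  have hae : (Metric.ball 0 R : Set E3) =ᵐ[MeasureTheory.volume]
      {x | -(Real.pi / 2) < capAngle R x ∧ capAngle R x < Real.pi / 2} := by
    -- The equator has `capAngle` equal to `arg 0 = 0` but lies outside the open ball; it is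
    -- discarded with its plane.
    filter_upwards [ae_two_ne_zero] with x hx
    refine propext ?_
    have him : 2 * R * x 2 ≠ 0 := by
      simp [hx, h0.ne']
    have hz : (⟨R ^ 2 - ‖x‖ ^ 2, 2 * R * x 2⟩ : ℂ) ≠ 0 := fun h =>
      him (by simpa using congrArg Complex.im h)
    have hb : x ∈ Metric.ball (0 : E3) R ↔ 0 < R ^ 2 - ‖x‖ ^ 2 := by
      rw [mem_ball_zero_iff, sub_pos, sq_lt_sq₀ (norm_nonneg x) h0.le]
    have ha : (-(Real.pi / 2) < capAngle R x ∧ capAngle R x < Real.pi / 2) ↔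
        0 < R ^ 2 - ‖x‖ ^ 2 := by
      rw [← abs_lt, capAngle, Complex.abs_arg_lt_pi_div_two_iff]
      simp [hz]
    exact hb.trans ha.symm
  have hac : hypVol.AbsolutelyContinuous MeasureTheory.volume :=
    (MeasureTheory.withDensity_absolutelyContinuous _ _).trans
      MeasureTheory.Measure.absolutelyContinuous_restrict
  have hk : ∀ φ ∈ Set.Icc (-(Real.pi / 2)) (Real.pi / 2), 0 < 1 + ch R * Real.cos φ := by
    intro φ hφ
    have := Real.cos_nonneg_of_mem_Icc hφ
    have := one_lt_ch h0 h1
    have : 0 < ch R := by linarith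
    positivity
  have hS := sh_pos h0 h1
  have hC := one_lt_ch h0 h1
  have hint := (integral_density h0.le h1 (by linarith : -(Real.pi / 2) ≤ Real.pi / 2) hk).2
  rw [MeasureTheory.measure_congr (hac.ae_eq hae), hypVol_region h0 h1 (by linarith) (by linarith)
    (by linarith) hk]
  congr 1
  simp only [mul_div_assoc]
  rw [intervalIntegral.integral_const_mul, hint, capPrim_neg h0.le h1 (hk _ ⟨by linarith, le_rfl⟩),
    sinh_diam h0 h1, diam, capPrim]
  have e : ch R + sh R = (1 + R) / (1 - R) := by
    have h2 : 1 - R ≠ 0 := by linarith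
    have h3 : 1 + R ≠ 0 := by linarith
    rw [ch, sh, show 1 - R ^ 2 = (1 - R) * (1 + R) by ring]
    field_simp
    ring
  simp only [Real.sin_pi_div_two, Real.cos_pi_div_two, mul_zero, mul_one, add_zero, div_one, e]
  ring

theorem RoundSphere.encloses_iff (S : RoundSphere) {v : ℝ} (hv : 0 < v) :
    S.Encloses v ↔ Real.sinh (diam S.R) - diam S.R = v / Real.pi := by
  have hp := Real.pi_pos
  have hd := diam_pos S.R_pos S.R_lt_one
  have hn : 0 ≤ Real.sinh (diam S.R) - diam S.R := sub_nonneg.2 (Real.self_le_sinh_iff.2 hd.le)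
  rw [RoundSphere.Encloses, hypVol_ball S.R_pos S.R_lt_one,
    ENNReal.ofReal_eq_ofReal_iff (by positivity) hv.le, eq_div_iff hp.ne', mul_comm]

theorem RoundSphere.area_eq (S : RoundSphere) :
    S.area = 2 * Real.pi * (Real.cosh (diam S.R) - 1) := by
  have hp := Real.pi_pos
  have h1 : Real.cos (-(Real.pi / 2)) = 0 := by simp
  rw [RoundSphere.area, capArea_eq S.R_pos S.R_lt_one (by linarith) (by linarith) (by simp),
    capArea_eq S.R_pos S.R_lt_one (by linarith) (by linarith) (by simp),
    cosh_diam S.R_pos S.R_lt_one, h1, Real.cos_pi_div_two]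
  ring

theorem existsUnique_roundSphere {v : ℝ} (hv : 0 < v) : ∃! S : RoundSphere, S.Encloses v := by
  have hp := Real.pi_pos
  obtain ⟨x, hx, he⟩ := exists_sinh_sub_self_eq (div_pos hv hp)
  obtain ⟨R, hR, rfl⟩ := exists_diam_eq hx
  refine ⟨⟨R, hR.1, hR.2⟩, (RoundSphere.encloses_iff _ hv).2 he, fun T hT => ?_⟩
  have h := (RoundSphere.encloses_iff _ hv).1 hT
  have hd := Real.sinh_sub_id_strictMono.injective (h.trans he.symm)
  have hTR := diam_injOn ⟨T.R_pos, T.R_lt_one⟩ hR hd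
  cases T
  cases hTR
  rfl

theorem sphereArea_spec {v : ℝ} (hv : 0 < v) : ∃ x, Real.sinh x - x = v / Real.pi ∧
    sphereArea v = 2 * Real.pi * (Real.cosh x - 1) := by
  have h := (existsUnique_roundSphere hv).exists
  refine ⟨diam h.choose.R, (RoundSphere.encloses_iff _ hv).1 h.choose_spec, ?_⟩
  rw [sphereArea, dif_pos h, RoundSphere.area_eq]

/-! ### Standard double bubbles in terms of `Adm` and `regionVol`, and the conclusion. -/

namespace StandardDoubleBubble

theorem adm (B : StandardDoubleBubble) : Adm B.ρ B.θ := by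
  have hp := Real.pi_pos
  have h1 := B.θ_gt
  have h2 := B.θ_lt
  refine ⟨B.ρ_pos.le, B.ρ_lt_one, h1, h2, ?_, ?_⟩
  · exact (cap_subset_H3_iff B.ρ_pos B.ρ_lt_one (by linarith) (by linarith)).1 B.upper_subset
  · have := (cap_subset_H3_iff B.ρ_pos B.ρ_lt_one (by linarith) (by linarith)).1 B.lower_subset
    rwa [← Real.cos_neg, neg_sub, sub_eq_neg_add] at this

theorem exists_of_adm {ρ θ : ℝ} (h0 : 0 < ρ) (h : Adm ρ θ) :
    ∃ B : StandardDoubleBubble, B.ρ = ρ ∧ B.θ = θ := by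
  have hp := Real.pi_pos
  have h1 := h.gt
  have h2 := h.lt
  refine ⟨⟨ρ, θ, h0, h.lt_one, h1, h2, ?_, ?_⟩, rfl, rfl⟩
  · exact (cap_subset_H3_iff h0 h.lt_one (by linarith) (by linarith)).2 h.upper
  · refine (cap_subset_H3_iff h0 h.lt_one (by linarith) (by linarith)).2 ?_
    rw [← Real.cos_neg, neg_sub, sub_eq_neg_add]
    exact h.lower

theorem encloses_iff (B : StandardDoubleBubble) {v w : ℝ} (hv : 0 < v) (hw : 0 < w) :
    B.Encloses v w ↔ regionVol B.ρ B.θ = v / Real.pi ∧ regionVol B.ρ (-B.θ) = w / Real.pi := by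
  have hp := Real.pi_pos
  have h1 := B.θ_gt
  have h2 := B.θ_lt
  have ha := B.adm
  have hpos : ∀ {θ}, Adm B.ρ θ → 0 < regionVol B.ρ θ := fun {θ} h => by
    have := regionVol_lt_of_lt_left h le_rfl B.ρ_pos
    rwa [regionVol_zero (by linarith [h.gt]) h.lt] at this
  have hku : ∀ φ ∈ Set.Icc B.θ (B.θ + 2 * Real.pi / 3), 0 < 1 + ch B.ρ * Real.cos φ :=
    fun φ hφ => ha.den_pos (by linarith [hφ.1]) hφ.2
  have hkl : ∀ φ ∈ Set.Icc (B.θ - 2 * Real.pi / 3) B.θ, 0 < 1 + ch B.ρ * Real.cos φ :=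
    fun φ hφ => ha.den_pos hφ.1 (by linarith [hφ.2])
  have hu : hypVol B.upperRegion = ENNReal.ofReal (Real.pi * regionVol B.ρ B.θ) := by
    rw [upperRegion, hypVol_region B.ρ_pos B.ρ_lt_one (by linarith) (by linarith) (by linarith) hku]
    congr 1
    simp only [mul_div_assoc Real.pi (sh B.ρ ^ 3)]
    rw [intervalIntegral.integral_const_mul,
      (integral_density B.ρ_pos.le B.ρ_lt_one (by linarith) hku).2, regionVol]
  have hl : hypVol B.lowerRegion = ENNReal.ofReal (Real.pi * regionVol B.ρ (-B.θ)) := by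
    rw [lowerRegion, hypVol_region B.ρ_pos B.ρ_lt_one (by linarith) (by linarith) (by linarith) hkl]
    congr 1
    simp only [mul_div_assoc Real.pi (sh B.ρ ^ 3)]
    rw [intervalIntegral.integral_const_mul,
      (integral_density B.ρ_pos.le B.ρ_lt_one (by linarith) hkl).2, ha.regionVol_neg]
  have hu0 := hpos ha
  have hl0 := hpos ha.neg
  rw [Encloses, hu, hl, ENNReal.ofReal_eq_ofReal_iff (by positivity) hv.le,
    ENNReal.ofReal_eq_ofReal_iff (by positivity) hw.le, eq_div_iff hp.ne', eq_div_iff hp.ne',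
    mul_comm, mul_comm Real.pi (regionVol B.ρ (-B.θ))]

theorem area_eq (B : StandardDoubleBubble) : B.area = 2 * Real.pi *
    (sh B.ρ ^ 2 / (1 + ch B.ρ * Real.cos (B.θ + 2 * Real.pi / 3)) +
      sh B.ρ ^ 2 / (1 + ch B.ρ * Real.cos (-B.θ + 2 * Real.pi / 3)) +
      sh B.ρ ^ 2 / (1 + ch B.ρ * Real.cos B.θ)) := by
  have hp := Real.pi_pos
  have h1 := B.θ_gt
  have h2 := B.θ_lt
  have ha := B.adm
  have e : Real.cos (B.θ - 2 * Real.pi / 3) = Real.cos (-B.θ + 2 * Real.pi / 3) := by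
    rw [← Real.cos_neg, neg_sub, sub_eq_neg_add]
  rw [area, capArea_eq B.ρ_pos B.ρ_lt_one (by linarith) (by linarith) ha.upper,
    capArea_eq B.ρ_pos B.ρ_lt_one (by linarith) (by linarith) (by rw [e]; exact ha.lower),
    capArea_eq B.ρ_pos B.ρ_lt_one (by linarith) (by linarith)
      (ha.den_pos (by linarith) (by linarith)), e]
  ring

theorem existsUnique {v w : ℝ} (hv : 0 < v) (hvw : v ≤ w) :
    ∃! B : StandardDoubleBubble, B.Encloses v w := by
  have hp := Real.pi_pos
  have hw : 0 < w := hv.trans_le hvw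
  obtain ⟨ρ, t, hρ, -, ha, hnv, hnw⟩ := bubble_exists (div_pos hv hp)
    (div_le_div_of_nonneg_right hvw hp.le)
  obtain ⟨B, hB, hθ⟩ := exists_of_adm hρ ha.neg
  have hBe : B.Encloses v w := by
    rw [B.encloses_iff hv hw, hB, hθ, neg_neg]
    exact ⟨hnv, hnw⟩
  refine ⟨B, hBe, fun B' hB' => ?_⟩
  obtain ⟨e1, e2⟩ := (B.encloses_iff hv hw).1 hBe
  obtain ⟨e3, e4⟩ := (B'.encloses_iff hv hw).1 hB'
  obtain ⟨e5, e6⟩ := bubble_unique B'.ρ_pos B.ρ_pos B'.adm B.adm (e3.trans e1.symm)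
    (e4.trans e2.symm)
  cases B'
  cases B
  cases e5
  cases e6
  rfl

end StandardDoubleBubble

/-- The double bubble with volumes `v ≤ w` has its inner cap at a nonpositive angle `-t`. -/
theorem doubleBubbleArea_spec {v w : ℝ} (hv : 0 < v) (hvw : v ≤ w) :
    ∃ ρ t, 0 < ρ ∧ 0 ≤ t ∧ Adm ρ t ∧ regionVol ρ (-t) = v / Real.pi ∧
      regionVol ρ t = w / Real.pi ∧ doubleBubbleArea v w = 2 * Real.pi *
        (sh ρ ^ 2 / (1 + ch ρ * Real.cos (-t + 2 * Real.pi / 3)) +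
          sh ρ ^ 2 / (1 + ch ρ * Real.cos (t + 2 * Real.pi / 3)) +
          sh ρ ^ 2 / (1 + ch ρ * Real.cos t)) := by
  have hp := Real.pi_pos
  have hw : 0 < w := hv.trans_le hvw
  obtain ⟨ρ, t, hρ, ht, ha, hnv, hnw⟩ := bubble_exists (div_pos hv hp)
    (div_le_div_of_nonneg_right hvw hp.le)
  obtain ⟨B, hB, hθ⟩ := StandardDoubleBubble.exists_of_adm hρ ha.neg
  have hBe : B.Encloses v w := by
    rw [B.encloses_iff hv hw, hB, hθ, neg_neg]
    exact ⟨hnv, hnw⟩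
  have hex : ∃ B : StandardDoubleBubble, B.Encloses v w := ⟨B, hBe⟩
  have hch : hex.choose = B :=
    (StandardDoubleBubble.existsUnique hv hvw).unique hex.choose_spec hBe
  refine ⟨ρ, t, hρ, ht, ha, hnv, hnw, ?_⟩
  rw [doubleBubbleArea, dif_pos hex, hch, B.area_eq, hB, hθ, neg_neg, Real.cos_neg]

end HypBubble

end

theorem theorem4p27 (v w : ℝ) (hvw : v ≤ w) (hw : 300 < w)
    (hv : (Real.exp 2 / 4 - 1) * w ≤ v) :
    HypBubble.HutchingsDefined v w ∧ 0 < HypBubble.hutchings v w := by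
  have hp := Real.pi_pos
  have hw0 : 0 < w := by linarith
  have he := HypBubble.exp_two_bounds.1
  have hv0 : 0 < v := (mul_pos (by linarith) hw0).trans_le hv
  refine ⟨⟨HypBubble.existsUnique_roundSphere (by linarith), HypBubble.existsUnique_roundSphere hw0,
    HypBubble.existsUnique_roundSphere (by linarith),
    HypBubble.StandardDoubleBubble.existsUnique hv0 hvw⟩, ?_⟩
  obtain ⟨x₁, h₁, e₁⟩ := HypBubble.sphereArea_spec (by linarith : 0 < v / 2)
  obtain ⟨x₂, h₂, e₂⟩ := HypBubble.sphereArea_spec hw0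
  obtain ⟨x₃, h₃, e₃⟩ := HypBubble.sphereArea_spec (by linarith : 0 < v + w)
  obtain ⟨ρ, t, hρ, ht, ha, hnv, hnw, e₄⟩ := HypBubble.doubleBubbleArea_spec hv0 hvw
  -- This is where w > 300 enters: 95 · 3.15 < 300.
  have h95 : 95 ≤ w / Real.pi := by
    rw [le_div_iff₀ hp]
    linarith [Real.pi_lt_d2]
  have h := HypBubble.hutchings_pos_of_adm (x₁ := x₁) (x₂ := x₂) (x₃ := x₃) hρ ht ha hnv hnw h95
    (by
      rw [← mul_div_assoc]
      gcongr)
    (by rw [h₁]; ring) h₂ (by rw [h₃]; ring)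
  rw [HypBubble.hutchings, e₁, e₂, e₃, e₄]
  linarith [mul_pos hp h]
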